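/- **Setting.** A vacuum graph $\mathcal G$ of the coloured Boulatov model is a finite closed bipartite $4$-coloured graph (multiple lines allowed): it has $\mathcal N/2$ black nodes and $\mathcal N/2$ white nodes, every line joins a black node to a white node and has a colour in $\{1,2,3,4\}$, and every node is the end of exactly one line of each colour. For a colour $\ell$, the set $\mathcal B_\ell$ of bubbles ($3$-bubbles) of colour $\ell$ is the set of connected components of the graph obtained from $\mathcal G$ by deleting all lines of colour $\ell$. The genus $g_b$ of $b\in\mathcal B_\ell$ is defined by $2-2g_b=|V_b|-|E_b|+|F_b|$, where $V_b,E_b,F_b$ are the vertices, edges and triangles of the triangulated surface dual to $b$: $|F_b|$ is the number of nodes of $b$, $|E_b|$ the number of lines of $b$, and $|V_b|$ the number of connected components of subgraphs obtained from $b$ by deleting all lines of one further colour $\ell'\neq\ell$, summed over the three $\ell'$. Let $dg$ be the Haar probability measure of $\mathrm{SU}(2)$, $\chi_j$ the character of the spin $j$ irreducible representation, and $\delta_t(g)=\sum_j(2j+1)e^{-tj(j+1)}\chi_j(g)$ for $t>0$, with $j\in\{0,\tfrac12,1,\dots\}$ for the model on $\mathrm{SU}(2)$ and $j\in\{0,1,2,\dots\}$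 for the model on $\mathrm{SO}(3)=\mathrm{SU}(2)/\{\pm1\}$ (functions on $\mathrm{SO}(3)$ being identified with even functions on $\mathrm{SU}(2)$). Let $(i,j,k)_\ell$ denote the ordered triples $234,\ 431,\ 412,\ 132$ for $\ell=1,2,3,4$. To each line of colour $\ell$ are attached group elements $G^\ell_{\ell'}$, $\ell'\neq\ell$. The regularized amplitude with coupling constant $\lambda\in\mathbb C$ is $$\mathcal A^{\mathcal G}_t(\lambda)=(\lambda\overline\lambda)^{\mathcal N/2}\int\prod_{\text{lines}}\Big[dG^\ell_i\,dG^\ell_j\,dG^\ell_k\;\delta(G^\ell_iG^\ell_jG^\ell_k)\Big]_{(i,j,k)=(i,j,k)_\ell}\ \prod_{\text{nodes}}\frac{\delta_t(G^2_1G^3_1G^4_1)\,\delta_t(G^4_2G^3_2G^1_2)\,\delta_t(G^4_3G^1_3G^2_3)\,\delta_t(G^1_4G^3_4G^2_4)}{\delta_t(\mathbf 1)},$$ where in the factor of a node $G^\ell_{\ell'}$ is the variable of the line of colour $\ell$ at that node, and $\int F(g_1,g_2,g_3)\,\delta(g_1g_2g_3)\,dg_1dg_2dg_3=\int F(x,y,(xy)^{-1})\,dx\,dy$.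 Rescale the coupling as $\lambda\to\lambda/\sqrt{\delta_t(\mathbf 1)}$ and define the divergence degree $$\gamma_{\mathcal G}=\inf\Big\{\gamma\in\mathbb R:\ \lim_{t\to0^+}\delta_t(\mathbf 1)^{-\gamma}\,\mathcal A^{\mathcal G}_t\big(\lambda/\sqrt{\delta_t(\mathbf 1)}\big)\ \text{exists and is finite}\Big\}\in[-\infty,+\infty].$$ **Proposition (3d bubble bound).** For the group $\mathrm{SU}(2)$ as well as for $\mathrm{SO}(3)$, for every connected (non-empty) vacuum graph $\mathcal G$, every $\lambda\in\mathbb C$ and every colour $\ell\in\{1,2,3,4\}$, $$\gamma_{\mathcal G}\ \le\ 2-2\sum_{b\in\mathcal B_\ell}g_b .$$ -/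

import Mathlib

open MeasureTheory Filter Topology

namespace Boulatov

/-! ### The group `SU(2)` and its normalised Haar measure -/

/-- The group `SU(2)`. -/
abbrev SU2 : Type := ↥(Matrix.specialUnitaryGroup (Fin 2) ℂ)

instance : IsTopologicalGroup SU2 where
  continuous_inv :=
    Continuous.subtype_mk (continuous_star.comp continuous_subtype_val) _

instance : CompactSpace SU2 := by
  apply isCompact_iff_compactSpace.mp
  have hc : IsCompact (Set.pi Set.univ fun _ : Fin 2 => Set.pi Set.univ fun _ : Fin 2 =>
      Metric.closedBall (0 : ℂ) 1) :=
    isCompact_univ_pi fun _ => isCompact_univ_pi fun _ => isCompact_closedBall 0 1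
  refine IsCompact.of_isClosed_subset (s := (Set.pi Set.univ fun _ : Fin 2 =>
    Set.pi Set.univ fun _ : Fin 2 => Metric.closedBall (0 : ℂ) 1 :
      Set (Matrix (Fin 2) (Fin 2) ℂ))) hc ?_ ?_
  · have h : (Matrix.specialUnitaryGroup (Fin 2) ℂ : Set (Matrix (Fin 2) (Fin 2) ℂ)) =
        {A | A * star A = 1} ∩ {A | A.det = 1} := by
      ext A
      simp [Matrix.mem_specialUnitaryGroup_iff, Matrix.mem_unitaryGroup_iff]
    rw [h]
    refine IsClosed.inter ?_ ?_
    · exact isClosed_eq (by fun_prop) continuous_const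
    · exact isClosed_eq (Continuous.matrix_det continuous_id) continuous_const
  · intro A hA
    simp only [Set.mem_pi, Set.mem_univ, true_implies, Metric.mem_closedBall, dist_zero_right]
    intro i j
    exact entry_norm_bound_of_unitary (Matrix.specialUnitaryGroup_le_unitaryGroup hA) i j

noncomputable instance : MeasurableSpace SU2 := borel SU2

instance : BorelSpace SU2 := ⟨rfl⟩

/-- The Haar probability measure `dg` on `SU(2)`. -/
noncomputable def haar : Measure SU2 := Measure.haarMeasure ⊤

/-! ### Characters and heat kernels -/

/-- The matrix of `g = (a, b; c, d)` in the spin `n / 2` irreducible representation of `SU(2)`, on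
binary forms of degree `n` written as polynomials of degree at most `n` in one variable `X`: the
`k`-th basis vector `X ^ k` is sent to `(a X + c) ^ k * (b X + d) ^ (n - k)`. -/
noncomputable def spinMatrix (n : ℕ) (g : SU2) : Matrix (Fin (n + 1)) (Fin (n + 1)) ℂ :=
  Matrix.of fun l k =>
    ((Polynomial.C (g.1 0 0) * Polynomial.X + Polynomial.C (g.1 1 0)) ^ (k : ℕ) *
      (Polynomial.C (g.1 0 1) * Polynomial.X + Polynomial.C (g.1 1 1)) ^ (n - (k : ℕ))).coeff
        (l : ℕ)

/-- The character `χ_j` of `SU(2)` of spin `j = n / 2`; it is real valued. -/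
noncomputable def character (n : ℕ) (g : SU2) : ℝ := (spinMatrix n g).trace.re

/-- The group on which the model is defined. Functions on `SO(3) = SU(2) / {±1}` are identified
with the functions `f` on `SU(2)` such that `f (-g) = f g`. -/
inductive GaugeGroup
  | SU2
  | SO3

/-- The representations of `SU(2)` that occur: all spins `m / 2` for `SU(2)`, and the integer
spins `m` for `SO(3)`. The value is twice the spin. -/
def GaugeGroup.twiceSpin : GaugeGroup → ℕ → ℕ
  | .SU2, m => m
  | .SO3, m => 2 * m

/-- The heat kernel `δ_t(g) = ∑_j (2 j + 1) exp (-t j (j + 1)) χ_j(g)`, where `j` runs over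
`{0, 1/2, 1, 3/2, …}` for `SU(2)` and over `{0, 1, 2, …}` for `SO(3)`. -/
noncomputable def heatKernel (K : GaugeGroup) (t : ℝ) (g : SU2) : ℝ :=
  ∑' m : ℕ, (2 * ((K.twiceSpin m : ℝ) / 2) + 1) *
    Real.exp (-t * ((K.twiceSpin m : ℝ) / 2) * ((K.twiceSpin m : ℝ) / 2 + 1)) *
      character (K.twiceSpin m) g

/-! ### Vacuum graphs -/

/-- A vacuum graph of the coloured model: a closed bipartite `4`-coloured graph. Its nodes are the
elements of `B` (interactions of the first kind) and of `W` (interactions of the conjugate kind);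
for each colour `ℓ` every node has exactly one line of colour `ℓ`, which joins `b : B` to
`line ℓ b : W`. The lines are thus the pairs `(b, ℓ)`. The colours `1, 2, 3, 4` are the elements
`0, 1, 2, 3` of `Fin 4`. -/
structure VacuumGraph (B W : Type*) where
  line : Fin 4 → B ≃ W

namespace VacuumGraph

variable {B W : Type*}

/-- The graph on all the nodes in which only the lines with colours in `C` are kept. -/
def restrict (G : VacuumGraph B W) (C : Set (Fin 4)) : SimpleGraph (B ⊕ W) where
  Adj x y := ∃ (b : B) (ℓ : Fin 4), ℓ ∈ C ∧
    ((x = Sum.inl b ∧ y = Sum.inr (G.line ℓ b)) ∨ (y = Sum.inl b ∧ x = Sum.inr (G.line ℓ b)))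
  symm := ⟨fun _ _ ⟨b, ℓ, hℓ, h⟩ => ⟨b, ℓ, hℓ, h.symm⟩⟩
  loopless := ⟨fun _ ⟨b, ℓ, _, h⟩ => by
    rcases h with ⟨h₁, h₂⟩ | ⟨h₁, h₂⟩ <;> exact Sum.inl_ne_inr (h₁.symm.trans h₂)⟩

/-- A vacuum graph is connected (in particular non-empty) if it is connected as a graph. -/
def Connected (G : VacuumGraph B W) : Prop := (G.restrict Set.univ).Connected

/-- The bubbles (`3`-bubbles) of colour `ℓ`: the connected components left after deleting all the
lines of colour `ℓ`. -/
abbrev Bubble (G : VacuumGraph B W) (ℓ : Fin 4) : Type _ :=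
  (G.restrict {ℓ}ᶜ).ConnectedComponent

noncomputable instance [Fintype B] [Fintype W] (G : VacuumGraph B W) (ℓ : Fin 4) :
    Fintype (G.Bubble ℓ) := Fintype.ofFinite _

/-- The vertices of the triangulated surface dual to the bubble `b` of colour `ℓ`. The vertices of
colour `ℓ' ≠ ℓ` are dual to the connected components of `b` after deleting in it the lines of
colour `ℓ'`. -/
def BubbleVertex (G : VacuumGraph B W) {ℓ : Fin 4} (b : G.Bubble ℓ) : Type _ :=
  {v : (ℓ' : Fin 4) × (G.restrict {ℓ, ℓ'}ᶜ).ConnectedComponent //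
    v.1 ≠ ℓ ∧ v.2.supp ⊆ b.supp}

/-- The edges of the triangulated surface dual to the bubble `b`: one for each line of `b`. -/
def BubbleEdge (G : VacuumGraph B W) {ℓ : Fin 4} (b : G.Bubble ℓ) : Type _ :=
  {e : B × Fin 4 // e.2 ≠ ℓ ∧ Sum.inl e.1 ∈ b.supp}

/-- The triangles of the triangulated surface dual to the bubble `b`: one for each node of `b`. -/
def BubbleFace (G : VacuumGraph B W) {ℓ : Fin 4} (b : G.Bubble ℓ) : Type _ := b.supp

/-- The genus `g_b` of the bubble `b`, defined by `2 - 2 g_b = |V_b| - |E_b| + |F_b|`. -/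
noncomputable def genus (G : VacuumGraph B W) {ℓ : Fin 4} (b : G.Bubble ℓ) : ℝ :=
  (2 - ((Nat.card (G.BubbleVertex b) : ℝ) - Nat.card (G.BubbleEdge b) +
    Nat.card (G.BubbleFace b))) / 2

end VacuumGraph

/-! ### Regularised Feynman amplitudes -/

/-- The cyclic ordering `(i, j, k)` of the three colours other than `ℓ`: in the colours
`1, 2, 3, 4` it is `234`, `431`, `412`, `132` for `ℓ = 1, 2, 3, 4`. It orders the arguments of the
field `ψ_ℓ` and the product of group elements around the vertex of colour `ℓ` of a tetrahedron. -/
def cyc : Fin 4 → Fin 3 → Fin 4 :=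
  ![![1, 2, 3], ![3, 2, 0], ![3, 0, 1], ![0, 2, 1]]

/-- The three group elements `G^ℓ_i, G^ℓ_j, G^ℓ_k`, `(i, j, k) = cyc ℓ`, carried by a line of
colour `ℓ`, as functions of the two of them that remain free: the propagator
`δ(G^ℓ_i G^ℓ_j G^ℓ_k)` sets `G^ℓ_k = (G^ℓ_i G^ℓ_j)⁻¹`. (The value at `v = ℓ` is never used.) -/
noncomputable def strand (ℓ : Fin 4) (x : SU2 × SU2) (v : Fin 4) : SU2 :=
  if v = cyc ℓ 0 then x.1
  else if v = cyc ℓ 1 then x.2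
  else if v = cyc ℓ 2 then (x.1 * x.2)⁻¹
  else 1

/-- The regularised interaction kernel, symmetric in the colours:
`δ_t(G²₁ G³₁ G⁴₁) δ_t(G⁴₂ G³₂ G¹₂) δ_t(G⁴₃ G¹₃ G²₃) δ_t(G¹₄ G³₄ G²₄) / δ_t(1)`,
where `G f v` is the group element of the triangle `f` at the vertex `v`. -/
noncomputable def interaction (K : GaugeGroup) (t : ℝ) (G : Fin 4 → Fin 4 → SU2) : ℝ :=
  (∏ v : Fin 4, heatKernel K t (G (cyc v 0) v * G (cyc v 1) v * G (cyc v 2) v)) /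
    heatKernel K t 1

/-- The regularised amplitude `A_t` of a vacuum graph with coupling constant `lam`: a factor
`lam` (resp. its conjugate) and an interaction kernel for each node in `B` (resp. `W`), and for
each line of colour `ℓ` a propagator `δ(g₁ g₂ g₃) ∏ᵢ δ(gᵢ gᵢ'⁻¹)`, which identifies the group
elements at its two ends and, as `∫ F(g₁, g₂, g₃) δ(g₁ g₂ g₃) dg₁ dg₂ dg₃ =
∫ F(x, y, (x y)⁻¹) dx dy`, leaves two Haar distributed variables for each line. -/
noncomputable def amplitude {B W : Type*} [Fintype B] [Fintype W] (K : GaugeGroup)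
    (G : VacuumGraph B W) (lam : ℂ) (t : ℝ) : ℝ :=
  (Complex.normSq lam) ^ Fintype.card B *
    ∫ x : B × Fin 4 → SU2 × SU2,
      (∏ b : B, interaction K t fun ℓ => strand ℓ (x (b, ℓ))) *
        (∏ w : W, interaction K t fun ℓ => strand ℓ (x ((G.line ℓ).symm w, ℓ)))
      ∂(Measure.pi fun _ => haar.prod haar)

/-- The rescaled coupling constant `lam / √(δ_t(1))`. -/
noncomputable def rescaledCoupling (K : GaugeGroup) (lam : ℂ) (t : ℝ) : ℂ :=
  lam / (Real.sqrt (heatKernel K t 1) : ℂ)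

/-- The divergence degree of a family `A t` of amplitudes: the infimum (in the extended reals) of
the real numbers `γ` such that `δ_t(1) ^ (-γ) * A t` has a finite limit as `t → 0⁺`. -/
noncomputable def divergenceDegree (K : GaugeGroup) (A : ℝ → ℝ) : EReal :=
  sInf ((fun γ : ℝ => (γ : EReal)) '' {γ : ℝ | ∃ L : ℝ,
    Tendsto (fun t => heatKernel K t 1 ^ (-γ) * A t) (𝓝[>] 0) (𝓝 L)})

end Boulatov

/-!
The amplitude is an integral over group elements of a product of heat kernels
`δ_t (G.holonomy x (n, v))`, one for each node `n` and each colour `v`, and of a power of `δ_t(1)`.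
Two properties of the heat kernel are used: `0 ≤ δ_t ≤ δ_t(1)`, and `∫ δ_t = 1`.

*Power counting.* On the line `e` of colour `f`, with group elements of product one, there is for
each `u ≠ f` an action of `SU(2)`, preserving the Haar measure, which fixes the group element of the
vertex `u` and translates those of the two other vertices. If it moves the argument of exactly one
factor of a product of heat kernels, this factor can be integrated out
(`VacuumGraph.lintegral_prod_erase`). All factors of colour `v = ℓ` are bounded by `δ_t(1)`; this
compensates the denominators of the interaction kernels. The other factors are grouped into faces,
the connected components left after deleting the lines of colours `ℓ` and `v`, which are the
vertices of the surfaces dual to the bubbles of colour `ℓ`. Around a face, consecutive factors share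
the group element of a line which occurs in no other factor considered, so that once a single factor
of the face is dropped (bounded by `δ_t(1)`), the others can be integrated out one by one. This gives
the bound with one power of `δ_t(1)` for each vertex. As the graph is connected, each bubble other
than a root has moreover a node, its anchor, whose line of colour `ℓ` leads to a bubble closer to the
root. The two free group elements on this line are used to integrate out two more factors, so that
nothing has to be dropped in two of the faces at the anchor. That this works in a suitable order is
`VacuumGraph.exists_peelable`: in every nonempty set of the remaining factors, some factor can be
integrated out; if none can by means of a line inside a bubble, the set is a union of faces without
a dropped factor, and in the bubble closest to the root it contains the factor at the anchor, which
the line towards the root removes. The resulting exponent is `2 - 2 ∑ g_b` by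
`VacuumGraph.two_sub_two_mul_sum_genus`.

*The heat kernel.* The character of spin `n / 2` is `U_n (cos θ)`, by the recursion
`formTrace_add_two` for the trace on binary forms. Hence the heat kernel of `SU(2)` is, up to a
positive factor, the derivative with respect to `x = cos θ` of the theta function
`∑ q ^ n² cos (n θ)` with `q = exp (-t / 4)`. A finite form of the Jacobi triple product shows that
this is a limit of multiples of derivatives of `∏ m < M, (1 + q ^ (4 m + 2) + 2 q ^ (2 m + 1) x)`,
which increase with `x` on `[-1, 1]`; so `δ_t ≥ 0` (`heatKernel_nonneg`). Nontrivial characters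
integrate to zero by the invariance of the Haar measure under the maximal torus and under one
rotation (`integral_character_eq_zero`), whence `∫ δ_t = 1`.
-/

namespace Boulatov

/-! ### The Haar probability measure of `SU(2)` -/

instance : SecondCountableTopology SU2 :=
  have : SecondCountableTopology (Matrix (Fin 2) (Fin 2) ℂ) :=
    inferInstanceAs (SecondCountableTopology (Fin 2 → Fin 2 → ℂ))
  inferInstanceAs (SecondCountableTopology
    ((Matrix.specialUnitaryGroup (Fin 2) ℂ : Set (Matrix (Fin 2) (Fin 2) ℂ))))

instance : haar.IsHaarMeasure := by unfold haar; infer_instance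

instance : IsProbabilityMeasure haar := ⟨by unfold haar; exact Measure.haarMeasure_self⟩

/-- A compact group is unimodular: a right translate of the Haar probability measure is again a
left invariant probability measure. -/
instance : haar.IsMulRightInvariant where
  map_mul_right_eq_self g := by
    have : IsProbabilityMeasure (haar.map (· * g)) :=
      Measure.isProbabilityMeasure_map (measurable_mul_const g).aemeasurable
    exact Measure.isHaarMeasure_eq_of_isProbabilityMeasure _ _

instance : haar.IsInvInvariant where
  inv_eq_self := by
    have h : haar.inv.IsMulLeftInvariant := inferInstance
    have : IsProbabilityMeasure haar.inv :=
      Measure.isProbabilityMeasure_map measurable_inv.aemeasurable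
    have : haar.inv.IsHaarMeasure := Measure.isHaarMeasure_of_isCompact_nonempty_interior _
      (Set.univ) isCompact_univ (by simp) (by simp) (by simp)
    exact Measure.isHaarMeasure_eq_of_isProbabilityMeasure _ _

/-- Integrating out one group element: the integral of `f (a g b)` or of `f (a g⁻¹ b)` over `g`
does not depend on `a` and `b`. -/
lemma lintegral_translate (f : SU2 → ENNReal) {s : SU2 → SU2} {a b : SU2}
    (hs : (∀ g, s g = a * g * b) ∨ ∀ g, s g = a * g⁻¹ * b) :
    ∫⁻ g, f (s g) ∂haar = ∫⁻ g, f g ∂haar := by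
  rcases hs with hs | hs
  · simp only [hs]
    rw [lintegral_mul_left_eq_self (μ := haar) (fun g => f (g * b)) a,
      lintegral_mul_right_eq_self (μ := haar) f b]
  · simp only [hs]
    rw [lintegral_inv_eq_self (μ := haar) (fun g => f (a * g * b)),
      lintegral_mul_left_eq_self (μ := haar) (fun g => f (g * b)) a,
      lintegral_mul_right_eq_self (μ := haar) f b]

/-! ### The characters of `SU(2)` -/

section TraceRecursion

open Polynomial

variable {R : Type*} [CommRing R]

/-- The matrix entries of the action of `(a, b; c, d)` on binary forms. -/
noncomputable def formCoeff (a b c d : R) (k m j : ℕ) : R :=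
  ((C a * X + C c) ^ k * (C b * X + C d) ^ m).coeff j

variable (a b c d : R)

lemma formCoeff_succ_left (k m j : ℕ) :
    formCoeff a b c d (k + 1) m (j + 1) =
      a * formCoeff a b c d k m j + c * formCoeff a b c d k m (j + 1) := by
  have : (C a * X + C c) ^ (k + 1) * (C b * X + C d) ^ m =
      C a * (((C a * X + C c) ^ k * (C b * X + C d) ^ m) * X) +
        C c * ((C a * X + C c) ^ k * (C b * X + C d) ^ m) := by ring
  simp only [formCoeff, this, coeff_add, coeff_C_mul, coeff_mul_X]

lemma formCoeff_succ_right (k m j : ℕ) :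
    formCoeff a b c d k (m + 1) (j + 1) =
      b * formCoeff a b c d k m j + d * formCoeff a b c d k m (j + 1) := by
  have : (C a * X + C c) ^ k * (C b * X + C d) ^ (m + 1) =
      C b * (((C a * X + C c) ^ k * (C b * X + C d) ^ m) * X) +
        C d * ((C a * X + C c) ^ k * (C b * X + C d) ^ m) := by ring
  simp only [formCoeff, this, coeff_add, coeff_C_mul, coeff_mul_X]

/-- The trace of the action of `(a, b; c, d)` on binary forms of degree `n`. -/
noncomputable def formTrace (n : ℕ) : R :=
  ∑ k ∈ Finset.range (n + 1), formCoeff a b c d k (n - k) k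

/-- The sum of the entries next to the diagonal of the action of `(a, b; c, d)` on binary forms
of degree `n`. -/
noncomputable def formSubtrace (n : ℕ) : R :=
  ∑ k ∈ Finset.range (n + 1), formCoeff a b c d k (n - k) (k + 1)

lemma formCoeff_zero_zero (m : ℕ) : formCoeff a b c d 0 m 0 = d ^ m := by
  simp [formCoeff, coeff_zero_eq_eval_zero]

lemma formTrace_succ (n : ℕ) :
    formTrace a b c d (n + 1) =
      d ^ (n + 1) + a * formTrace a b c d n + c * formSubtrace a b c d n := by
  rw [formTrace, Finset.sum_range_succ', formTrace, formSubtrace]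
  simp only [formCoeff_succ_left, Nat.add_sub_add_right, Nat.sub_zero, formCoeff_zero_zero,
    Finset.sum_add_distrib, Finset.mul_sum]
  ring

lemma formSubtrace_succ (n : ℕ) :
    formSubtrace a b c d (n + 1) = b * formTrace a b c d n + d * formSubtrace a b c d n := by
  rw [formSubtrace, Finset.sum_range_succ, formTrace, formSubtrace, Finset.mul_sum,
    Finset.mul_sum, ← Finset.sum_add_distrib]
  have h0 : formCoeff a b c d (n + 1) (n + 1 - (n + 1)) (n + 1 + 1) = 0 := by
    rw [formCoeff]
    apply coeff_eq_zero_of_natDegree_lt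
    have h1 : (C a * X + C c).natDegree ≤ 1 := natDegree_linear_le
    have h2 := natDegree_pow_le_of_le (n + 1) h1
    simp only [Nat.sub_self, pow_zero, mul_one]
    omega
  rw [h0, add_zero]
  refine Finset.sum_congr rfl fun k hk => ?_
  have : n + 1 - k = n - k + 1 := by
    have := Finset.mem_range.1 hk
    omega
  rw [this, formCoeff_succ_right]

/-- The characters satisfy the recursion of the Chebyshev polynomials of the second kind. -/
lemma formTrace_add_two (h : a * d - b * c = 1) (n : ℕ) :
    formTrace a b c d (n + 2) = (a + d) * formTrace a b c d (n + 1) - formTrace a b c d n := by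
  rw [formTrace_succ a b c d (n + 1), formSubtrace_succ]
  linear_combination (-formTrace a b c d n) * h - d * formTrace_succ a b c d n

lemma formTrace_zero : formTrace a b c d 0 = 1 := by simp [formTrace, formCoeff]

lemma formTrace_one : formTrace a b c d 1 = a + d := by
  simp [formTrace, Finset.sum_range_succ, formCoeff, add_comm]

end TraceRecursion

open Polynomial.Chebyshev

lemma SU2.det_eq (g : SU2) : g.1 0 0 * g.1 1 1 - g.1 0 1 * g.1 1 0 = 1 := by
  have := (Matrix.mem_specialUnitaryGroup_iff.1 g.2).2
  rwa [Matrix.det_fin_two] at this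

lemma SU2.star_zero_zero (g : SU2) : star (g.1 0 0) = g.1 1 1 := by
  have h1 : g.1⁻¹ = star g.1 := by
    apply Matrix.inv_eq_left_inv
    exact Matrix.mem_unitaryGroup_iff'.1 (Matrix.mem_specialUnitaryGroup_iff.1 g.2).1
  have h2 : g.1⁻¹ 0 0 = g.1 1 1 := by
    rw [Matrix.inv_def, (Matrix.mem_specialUnitaryGroup_iff.1 g.2).2, Matrix.adjugate_fin_two]
    simp
  rw [← h2, h1]
  simp [Matrix.star_apply]

/-- The cosine of the class angle of an element of `SU(2)`, half its trace. -/
noncomputable def cosAngle (g : SU2) : ℝ := (g.1 0 0).re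

lemma trace_eq_two_mul_cosAngle (g : SU2) : g.1 0 0 + g.1 1 1 = ((2 * cosAngle g : ℝ) : ℂ) := by
  rw [← SU2.star_zero_zero, cosAngle]
  apply Complex.ext <;> simp [two_mul]

lemma abs_cosAngle_le (g : SU2) : |cosAngle g| ≤ 1 :=
  (Complex.abs_re_le_norm _).trans
    (entry_norm_bound_of_unitary (Matrix.specialUnitaryGroup_le_unitaryGroup g.2) 0 0)

lemma cosAngle_one : cosAngle 1 = 1 := by simp [cosAngle]

lemma continuous_cosAngle : Continuous cosAngle :=
  Complex.continuous_re.comp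
    ((continuous_apply 0).comp ((continuous_apply 0).comp continuous_subtype_val))

lemma trace_spinMatrix_eq_formTrace (n : ℕ) (g : SU2) :
    (spinMatrix n g).trace =
      formTrace (g.1 0 0) (g.1 0 1) (g.1 1 0) (g.1 1 1) n := by
  rw [Matrix.trace, formTrace, ← Fin.sum_univ_eq_sum_range
    (fun k => formCoeff (g.1 0 0) (g.1 0 1) (g.1 1 0) (g.1 1 1) k (n - k) k)]
  rfl

lemma trace_spinMatrix (n : ℕ) (g : SU2) :
    (spinMatrix n g).trace = (((U ℝ n).eval (cosAngle g) : ℝ) : ℂ) := by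
  rw [trace_spinMatrix_eq_formTrace]
  induction n using Nat.twoStepInduction with
  | zero => simp [formTrace_zero]
  | one => simp [formTrace_one, trace_eq_two_mul_cosAngle]
  | more n ih1 ih2 =>
    rw [formTrace_add_two _ _ _ _ (SU2.det_eq g), ih1, ih2, trace_eq_two_mul_cosAngle]
    push_cast
    rw [U_add_two]
    simp

/-- The character of spin `n / 2` is the Chebyshev polynomial of the second kind of degree `n` in
the cosine of the class angle. -/
lemma character_eq (n : ℕ) (g : SU2) : character n g = (U ℝ n).eval (cosAngle g) := by
  rw [character, trace_spinMatrix, Complex.ofReal_re]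

lemma abs_eval_U_le (n : ℕ) {x : ℝ} (hx : |x| ≤ 1) : |(U ℝ n).eval x| ≤ n + 1 := by
  induction n using Nat.twoStepInduction with
  | zero => simp
  | one => simp [abs_mul]; linarith
  | more n ih1 ih2 =>
    have h := congrArg (Polynomial.eval x) (U_eq_two_mul_T_add_U ℝ n)
    simp only [Polynomial.eval_add, Polynomial.eval_mul, Polynomial.eval_ofNat] at h
    push_cast
    rw [h]
    have hT := abs_eval_T_real_le_one (n + 2) hx
    calc _ ≤ |2 * (T ℝ (n + 2)).eval x| + |(U ℝ n).eval x| := abs_add_le _ _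
      _ ≤ 2 * 1 + (n + 1) := by
        rw [abs_mul, abs_two]
        gcongr
      _ = _ := by ring

lemma continuous_character (n : ℕ) : Continuous (character n) := by
  simp only [funext (character_eq n)]
  exact (Polynomial.continuous _).comp continuous_cosAngle

lemma abs_character_le (n : ℕ) (g : SU2) : |character n g| ≤ n + 1 := by
  rw [character_eq]
  exact abs_eval_U_le n (abs_cosAngle_le g)

lemma character_one (n : ℕ) : character n 1 = n + 1 := by
  rw [character_eq, cosAngle_one, U_eval_one]
  simp

/-! ### Orthogonality of the characters to the constants -/

lemma continuous_coeff_mul {α R : Type*} [TopologicalSpace α] [CommRing R] [TopologicalSpace R]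
    [IsTopologicalRing R] {p q : α → Polynomial R} (hp : ∀ j, Continuous fun x => (p x).coeff j)
    (hq : ∀ j, Continuous fun x => (q x).coeff j) (j : ℕ) :
    Continuous fun x => (p x * q x).coeff j := by
  simp only [Polynomial.coeff_mul]
  exact continuous_finsetSum _ fun i _ => (hp _).mul (hq _)

lemma continuous_coeff_pow {α R : Type*} [TopologicalSpace α] [CommRing R] [TopologicalSpace R]
    [IsTopologicalRing R] {p : α → Polynomial R} (hp : ∀ j, Continuous fun x => (p x).coeff j)
    (n : ℕ) : ∀ j, Continuous fun x => (p x ^ n).coeff j := by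
  induction n with
  | zero => simpa using fun _ => continuous_const
  | succ n ih => simpa only [pow_succ] using continuous_coeff_mul ih hp

/-- The matrix entries of the representations of `SU(2)` on binary forms, as functions on the
group. -/
noncomputable def spinCoeff (k m j : ℕ) (g : SU2) : ℂ :=
  formCoeff (g.1 0 0) (g.1 0 1) (g.1 1 0) (g.1 1 1) k m j

lemma SU2.continuous_entry (i j : Fin 2) : Continuous fun g : SU2 => g.1 i j :=
  (continuous_apply j).comp ((continuous_apply i).comp continuous_subtype_val)

lemma continuous_spinCoeff (k m j : ℕ) : Continuous (spinCoeff k m j) := by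
  have lin : ∀ (u v : SU2 → ℂ), Continuous u → Continuous v → ∀ j,
      Continuous fun g => (Polynomial.C (u g) * Polynomial.X + Polynomial.C (v g)).coeff j := by
    intro u v hu hv j
    rcases j with _ | _ | j
    · simpa using hv
    · simpa [Polynomial.coeff_C] using hu
    · simpa [Polynomial.coeff_C, Polynomial.coeff_X] using continuous_const
  exact continuous_coeff_mul
    (continuous_coeff_pow (lin _ _ (SU2.continuous_entry 0 0) (SU2.continuous_entry 1 0)) k)
    (continuous_coeff_pow (lin _ _ (SU2.continuous_entry 0 1) (SU2.continuous_entry 1 1)) m) j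

lemma integrable_spinCoeff (k m j : ℕ) : Integrable (spinCoeff k m j) haar :=
  (continuous_spinCoeff k m j).integrable_of_hasCompactSupport
    (HasCompactSupport.of_compactSpace _)

/-- The matrix `(a, b; -b̄, ā)` of `SU(2)`. -/
def SU2.mk (a b : ℂ) (h : a * star a + b * star b = 1) : SU2 :=
  ⟨!![a, b; -star b, star a], by
    rw [Matrix.mem_specialUnitaryGroup_iff, Matrix.mem_unitaryGroup_iff]
    refine ⟨?_, ?_⟩
    · ext i j
      fin_cases i <;> fin_cases j <;>
        simp [Matrix.mul_apply, Fin.sum_univ_two, Matrix.star_apply] <;>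
        simp only [Complex.star_def] at h <;>
        first | linear_combination h | ring
    · rw [Matrix.det_fin_two_of]
      linear_combination h⟩

lemma formCoeff_torus (a b c d u v : ℂ) (huv : u * v = 1) (k m j : ℕ) :
    formCoeff (u * a) (u * b) (v * c) (v * d) k m j =
      v ^ (k + m) * u ^ (2 * j) * formCoeff a b c d k m j := by
  have h : ∀ x y : ℂ, Polynomial.C (u * x) * Polynomial.X + Polynomial.C (v * y) =
      Polynomial.C v * (Polynomial.C x * Polynomial.X + Polynomial.C y).comp
        (Polynomial.C (u ^ 2) * Polynomial.X) := by
    intro x y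
    simp only [Polynomial.add_comp, Polynomial.mul_comp, Polynomial.C_comp, Polynomial.X_comp]
    have : Polynomial.C (u * x) = Polynomial.C (v * (x * u ^ 2)) := by
      congr 1
      linear_combination (-(u * x)) * huv
    rw [this]
    simp only [Polynomial.C_mul]
    ring
  rw [formCoeff, h, h, mul_pow, mul_pow, mul_mul_mul_comm, ← Polynomial.pow_comp,
    ← Polynomial.pow_comp, ← Polynomial.mul_comp, ← Polynomial.C_pow, ← Polynomial.C_pow,
    ← Polynomial.C_mul, Polynomial.coeff_C_mul, Polynomial.comp_C_mul_X_coeff, formCoeff]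
  ring

/-- Invariance under the maximal torus kills the matrix entries of nonzero weight. -/
lemma integral_spinCoeff_eq_zero {k m j : ℕ} (h : 2 * j ≠ k + m) :
    ∫ g, spinCoeff k m j g ∂haar = 0 := by
  -- the torus element whose angle is `π` divided by the weight
  set w : ℝ := 2 * j - (k + m) with hw
  have hw0 : w ≠ 0 := by
    rw [hw, sub_ne_zero]
    exact_mod_cast h
  set u : ℂ := Complex.exp ((Real.pi / w : ℝ) * Complex.I) with hu
  have hstar : star u = Complex.exp (-((Real.pi / w : ℝ) * Complex.I)) := by
    rw [hu, Complex.star_def, ← Complex.exp_conj, map_mul, Complex.conj_ofReal, Complex.conj_I,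
      mul_neg]
  have huv : u * star u = 1 := by rw [hstar, ← Complex.exp_add]; simp
  have hpow : (star u) ^ (k + m) * u ^ (2 * j) = -1 := by
    rw [hstar, ← Complex.exp_nat_mul, ← Complex.exp_nat_mul, ← Complex.exp_add,
      ← Complex.exp_pi_mul_I]
    congr 1
    have : ((Real.pi : ℝ) : ℂ) = ((Real.pi / w * w : ℝ) : ℂ) := by
      rw [div_mul_cancel₀ _ hw0]
    rw [this, hw]
    push_cast
    ring
  refine integral_eq_zero_of_mul_left_eq_neg (g := SU2.mk u 0 (by simpa using huv)) fun g => ?_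
  have : ∀ i j, (SU2.mk u 0 (by simpa using huv) * g).1 i j =
      (!![u, 0; -star 0, star u] * g.1) i j := fun i j => rfl
  simp only [spinCoeff, this, Matrix.mul_apply, Fin.sum_univ_two, Matrix.of_apply,
    Matrix.cons_val', Matrix.cons_val_zero, Matrix.cons_val_one, star_zero, neg_zero, zero_mul,
    add_zero, zero_add, Matrix.cons_val_fin_one]
  rw [formCoeff_torus _ _ _ _ _ _ huv, hpow, neg_one_mul]

lemma sum_formCoeff (a b c d : ℂ) (k m : ℕ) :
    ∑ j ∈ Finset.range (k + m + 1), formCoeff a b c d k m j = (a + c) ^ k * (b + d) ^ m := by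
  have h1 : ∀ x y : ℂ, (Polynomial.C x * Polynomial.X + Polynomial.C y).natDegree ≤ 1 :=
    fun x y => Polynomial.natDegree_linear_le
  have hd : ((Polynomial.C a * Polynomial.X + Polynomial.C c) ^ k *
      (Polynomial.C b * Polynomial.X + Polynomial.C d) ^ m).natDegree < k + m + 1 := by
    have h2 := Polynomial.natDegree_pow_le_of_le k (h1 a c)
    have h3 := Polynomial.natDegree_pow_le_of_le m (h1 b d)
    have h4 := Polynomial.natDegree_mul_le_of_le h2 h3
    omega
  have := Polynomial.eval_eq_sum_range' hd (1 : ℂ)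
  simpa [formCoeff] using this.symm

/-- The entry of weight zero has vanishing integral too: evaluated at `X = 1`, the image of
`X ^ m` under a rotation by `π / 4` is a multiple of an entry of nonzero weight. -/
lemma integral_spinCoeff_diag_eq_zero {m : ℕ} (hm : m ≠ 0) :
    ∫ g, spinCoeff m m m g ∂haar = 0 := by
  have h1 : ∫ g, spinCoeff m m m g ∂haar =
      ∫ g : SU2, (g.1 0 0 + g.1 1 0) ^ m * (g.1 0 1 + g.1 1 1) ^ m ∂haar := by
    simp only [← sum_formCoeff]
    change _ = ∫ g : SU2, ∑ j ∈ Finset.range (m + m + 1), spinCoeff m m j g ∂haar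
    rw [integral_finsetSum _ fun j _ => integrable_spinCoeff m m j,
      Finset.sum_eq_single_of_mem m (by simp)]
    intro j _ hj
    exact integral_spinCoeff_eq_zero (by omega)
  set s : ℂ := (((Real.sqrt 2)⁻¹ : ℝ) : ℂ) with hs
  have hs2 : s * star s + s * star s = 1 := by
    rw [hs, Complex.star_def, Complex.conj_ofReal, ← Complex.ofReal_mul, ← mul_inv,
      Real.mul_self_sqrt (by norm_num)]
    push_cast
    norm_num
  have hss : star s = s := by rw [hs, Complex.star_def, Complex.conj_ofReal]
  have h0 : ∀ g : SU2, (g.1 1 0) ^ m * (g.1 1 1) ^ m = spinCoeff m m 0 g := by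
    intro g
    simp [spinCoeff, formCoeff, Polynomial.coeff_zero_eq_eval_zero]
  rw [h1, ← integral_mul_left_eq_self _ (SU2.mk s s hs2)]
  have hg : ∀ g : SU2, ∀ i j, (SU2.mk s s hs2 * g).1 i j =
      (!![s, s; -star s, star s] * g.1) i j := fun _ i j => rfl
  have key : ∀ g : SU2,
      ((SU2.mk s s hs2 * g).1 0 0 + (SU2.mk s s hs2 * g).1 1 0) ^ m *
        ((SU2.mk s s hs2 * g).1 0 1 + (SU2.mk s s hs2 * g).1 1 1) ^ m =
      (2 * s) ^ (m + m) * spinCoeff m m 0 g := by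
    intro g
    rw [← h0]
    simp only [hg, hss, Matrix.mul_apply, Fin.sum_univ_two, Matrix.of_apply,
      Matrix.cons_val', Matrix.cons_val_zero, Matrix.cons_val_one, Matrix.cons_val_fin_one]
    have e : ∀ x y : ℂ, s * x + s * y + (-s * x + s * y) = 2 * s * y := fun x y => by ring
    rw [e, e]
    generalize 2 * s = r
    ring
  simp only [key]
  rw [integral_const_mul, integral_spinCoeff_eq_zero (by omega), mul_zero]

lemma integral_character_eq_zero {n : ℕ} (hn : n ≠ 0) : ∫ g, character n g ∂haar = 0 := by
  have h1 : ∀ g, (spinMatrix n g).trace = ∑ k ∈ Finset.range (n + 1), spinCoeff k (n - k) k g :=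
    fun g => trace_spinMatrix_eq_formTrace n g
  have h2 : ∫ g, (spinMatrix n g).trace ∂haar = 0 := by
    simp only [h1]
    rw [integral_finsetSum _ fun j _ => integrable_spinCoeff _ _ j]
    refine Finset.sum_eq_zero fun k hk => ?_
    have hk' := Finset.mem_range.1 hk
    by_cases hkn : 2 * k = k + (n - k)
    · have : n - k = k := by omega
      rw [this]
      exact integral_spinCoeff_diag_eq_zero (by omega)
    · exact integral_spinCoeff_eq_zero hkn
  have h3 : ∀ g, (spinMatrix n g).trace = ((character n g : ℝ) : ℂ) := fun g => by
    rw [character_eq, trace_spinMatrix]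
  simp only [h3] at h2
  rw [integral_complex_ofReal] at h2
  exact_mod_cast h2

/-! ### A finite form of the Jacobi triple product -/

section TripleProduct

open Polynomial.Chebyshev

/-- `1 / ((1 - q²) (1 - q⁴) ⋯ (1 - q²ᵏ))`, extended by zero to negative `k`, so that the recursion
`invQPochhammer_sub_one` holds for all integers. -/
noncomputable def invQPochhammer (q : ℝ) (k : ℤ) : ℝ :=
  if k < 0 then 0 else ∏ i ∈ Finset.range k.toNat, (1 - q ^ (2 * (i + 1)))⁻¹

/-- The coefficient of `T n` in the expansion of `∏ m < M, (1 + q ^ (4 m + 2) + 2 q ^ (2 m + 1) x)`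
in Chebyshev polynomials, symmetric in the integers `n` and `-n`, up to a positive factor which
depends on `M` only: a Gaussian binomial coefficient times `q ^ n²`. -/
noncomputable def tripleCoeff (q : ℝ) (M : ℕ) (n : ℤ) : ℝ :=
  q ^ (n * n) * (invQPochhammer q (M + n) * invQPochhammer q (M - n))

variable {q : ℝ}

lemma invQPochhammer_of_neg {k : ℤ} (hk : k < 0) : invQPochhammer q k = 0 := if_pos hk

lemma invQPochhammer_natCast (k : ℕ) :
    invQPochhammer q k = ∏ i ∈ Finset.range k, (1 - q ^ (2 * (i + 1)))⁻¹ := by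
  simp [invQPochhammer]

lemma one_sub_pow_pos (h0 : 0 < q) (h1 : q < 1) {n : ℕ} (hn : n ≠ 0) : 0 < 1 - q ^ n :=
  sub_pos.2 (pow_lt_one₀ h0.le h1 hn)

lemma invQPochhammer_natCast_pos (h0 : 0 < q) (h1 : q < 1) (k : ℕ) :
    0 < invQPochhammer q k := by
  rw [invQPochhammer_natCast]
  exact Finset.prod_pos fun i _ => inv_pos.2 (one_sub_pow_pos h0 h1 (by omega))

lemma invQPochhammer_nonneg (h0 : 0 < q) (h1 : q < 1) (k : ℤ) : 0 ≤ invQPochhammer q k := by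
  rcases lt_or_ge k 0 with hk | hk
  · rw [invQPochhammer_of_neg hk]
  · lift k to ℕ using hk
    exact (invQPochhammer_natCast_pos h0 h1 k).le

lemma invQPochhammer_sub_one (h0 : 0 < q) (h1 : q < 1) (k : ℤ) :
    invQPochhammer q (k - 1) = (1 - q ^ (2 * k)) * invQPochhammer q k := by
  rcases lt_trichotomy k 0 with hk | rfl | hk
  · rw [invQPochhammer_of_neg hk, invQPochhammer_of_neg (by omega), mul_zero]
  · simp [invQPochhammer]
  · obtain ⟨m, rfl⟩ : ∃ m : ℕ, k = ((m + 1 : ℕ) : ℤ) := ⟨(k - 1).toNat, by omega⟩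
    have h : (((m + 1 : ℕ) : ℤ) - 1) = (m : ℤ) := by push_cast; ring
    have hz : q ^ (2 * ((m + 1 : ℕ) : ℤ)) = q ^ (2 * (m + 1)) := by
      rw [← zpow_natCast]; push_cast; rfl
    rw [h, invQPochhammer_natCast, invQPochhammer_natCast, Finset.prod_range_succ, hz]
    have := (one_sub_pow_pos h0 h1 (n := 2 * (m + 1)) (by omega)).ne'
    field_simp

lemma tripleCoeff_eq_zero {M : ℕ} {n : ℤ} (h : n ∉ Set.Icc (-(M : ℤ)) M) :
    tripleCoeff q M n = 0 := by
  rw [Set.mem_Icc, not_and_or, not_le, not_le] at h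
  rcases h with h | h
  · rw [tripleCoeff, invQPochhammer_of_neg (by omega), zero_mul, mul_zero]
  · rw [tripleCoeff, invQPochhammer_of_neg (k := M - n) (by omega), mul_zero, mul_zero]

lemma finite_support_tripleCoeff (M : ℕ) : (Function.support (tripleCoeff q M)).Finite :=
  (Set.finite_Icc _ _).subset fun _ hn => by_contra fun h => hn (tripleCoeff_eq_zero h)

/-- The Pascal rule for the coefficients of the triple product. -/
lemma tripleCoeff_succ (h0 : 0 < q) (h1 : q < 1) (M : ℕ) (n : ℤ) :
    (1 - q ^ (4 * M + 2)) * (1 - q ^ (4 * M + 4)) * tripleCoeff q (M + 1) n =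
      (1 + q ^ (4 * M + 2)) * tripleCoeff q M n +
        q ^ (2 * M + 1) * (tripleCoeff q M (n - 1) + tripleCoeff q M (n + 1)) := by
  have hq := h0.ne'
  have e1 := invQPochhammer_sub_one h0 h1 (M + 1 + n)
  have e2 := invQPochhammer_sub_one h0 h1 (M + 1 - n)
  have e3 := invQPochhammer_sub_one h0 h1 (M + n)
  have e4 := invQPochhammer_sub_one h0 h1 (M - n)
  rw [show (M + 1 + n - 1 : ℤ) = M + n by ring] at e1
  rw [show (M + 1 - n - 1 : ℤ) = M - n by ring] at e2
  rw [e1] at e3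
  rw [e2] at e4
  simp only [tripleCoeff, Nat.cast_add, Nat.cast_one]
  rw [show (M + (n - 1) : ℤ) = M + n - 1 by ring, show (M - (n - 1) : ℤ) = M + 1 - n by ring,
    show (M + (n + 1) : ℤ) = M + 1 + n by ring, show (M - (n + 1) : ℤ) = M - n - 1 by ring,
    e3, e4, e1, e2]
  generalize invQPochhammer q (M + 1 + n) = r
  generalize invQPochhammer q (M + 1 - n) = s
  -- in the variables `q ^ M` and `q ^ n` the claim is a polynomial identity
  have z1 : q ^ (2 * (M + n : ℤ)) = (q ^ M) ^ 2 * (q ^ n) ^ 2 := by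
    rw [mul_comm, zpow_mul, zpow_add₀ hq, zpow_natCast]; norm_cast; ring
  have z2 : q ^ (2 * (M - n : ℤ)) = (q ^ M) ^ 2 / (q ^ n) ^ 2 := by
    rw [mul_comm, zpow_mul, zpow_sub₀ hq, zpow_natCast]; norm_cast; rw [div_pow]
  have z3 : q ^ (2 * (M + 1 + n : ℤ)) = q ^ 2 * (q ^ M) ^ 2 * (q ^ n) ^ 2 := by
    rw [show (2 * (M + 1 + n) : ℤ) = 2 + 2 * (M + n) by ring, zpow_add₀ hq, z1]
    norm_cast; ring
  have z4 : q ^ (2 * (M + 1 - n : ℤ)) = q ^ 2 * (q ^ M) ^ 2 / (q ^ n) ^ 2 := by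
    rw [show (2 * (M + 1 - n) : ℤ) = 2 + 2 * (M - n) by ring, zpow_add₀ hq, z2]
    norm_cast; ring
  have z5 : q ^ ((n - 1) * (n - 1)) = q ^ (n * n) * q / (q ^ n) ^ 2 := by
    rw [show (n - 1) * (n - 1) = n * n + 1 - n * 2 by ring, zpow_sub₀ hq, zpow_add₀ hq,
      zpow_mul q n 2]
    norm_cast
    rw [pow_one]
  have z6 : q ^ ((n + 1) * (n + 1)) = q ^ (n * n) * q * (q ^ n) ^ 2 := by
    rw [show (n + 1) * (n + 1) = n * n + 1 + n * 2 by ring, zpow_add₀ hq, zpow_add₀ hq,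
      zpow_mul q n 2]
    norm_cast
    rw [pow_one]
  rw [z1, z2, z3, z4, z5, z6]
  have p1 : q ^ (4 * M + 2) = (q ^ M) ^ 4 * q ^ 2 := by ring
  have p2 : q ^ (4 * M + 4) = (q ^ M) ^ 4 * q ^ 4 := by ring
  have p3 : q ^ (2 * M + 1) = (q ^ M) ^ 2 * q := by ring
  rw [p1, p2, p3]
  have hy : q ^ n ≠ 0 := zpow_ne_zero _ hq
  generalize q ^ n = y at hy ⊢
  generalize q ^ M = z
  generalize q ^ (n * n) = w
  field_simp
  ring

lemma summable_mul_of_finite_support {A : ℤ → ℝ} (hA : (Function.support A).Finite) (f : ℤ → ℝ) :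
    Summable fun n => A n * f n :=
  summable_of_hasFiniteSupport (hA.subset fun n hn h => hn (by simp [h]))

lemma tsum_mul_of_three_term {A A' : ℤ → ℝ} (hA : (Function.support A).Finite) {c α β : ℝ}
    (h : ∀ n, c * A' n = α * A n + β * (A (n - 1) + A (n + 1))) (f : ℤ → ℝ) :
    c * ∑' n, A' n * f n = ∑' n, A n * (α * f n + β * (f (n + 1) + f (n - 1))) := by
  have s1 : Summable fun n => A (n - 1) * f n := by
    rw [← (Equiv.addRight (1 : ℤ)).summable_iff]
    simpa [Function.comp_def] using summable_mul_of_finite_support hA fun n => f (n + 1)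
  have s2 : Summable fun n => A (n + 1) * f n := by
    rw [← (Equiv.addRight (-1 : ℤ)).summable_iff]
    simpa [Function.comp_def] using summable_mul_of_finite_support hA fun n => f (n + -1)
  have t1 : ∑' n, A (n - 1) * f n = ∑' n, A n * f (n + 1) := by
    rw [← (Equiv.addRight (1 : ℤ)).tsum_eq]
    simp
  have t2 : ∑' n, A (n + 1) * f n = ∑' n, A n * f (n - 1) := by
    rw [← (Equiv.addRight (-1 : ℤ)).tsum_eq]
    simp [sub_eq_add_neg]
  have s0 := summable_mul_of_finite_support hA f
  have s3 := summable_mul_of_finite_support hA fun n => f (n + 1)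
  have s4 := summable_mul_of_finite_support hA fun n => f (n - 1)
  have e1 : ∀ n, c * (A' n * f n) =
      α * (A n * f n) + β * (A (n - 1) * f n + A (n + 1) * f n) := fun n => by
    linear_combination f n * h n
  have e2 : ∀ n, A n * (α * f n + β * (f (n + 1) + f (n - 1))) =
      α * (A n * f n) + β * (A n * f (n + 1) + A n * f (n - 1)) := fun n => by ring
  rw [← tsum_mul_left]
  simp only [e1, e2]
  rw [(s0.mul_left α).tsum_add ((s1.add s2).mul_left β), tsum_mul_left, tsum_mul_left,
    s1.tsum_add s2, t1, t2, (s0.mul_left α).tsum_add ((s3.add s4).mul_left β), tsum_mul_left,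
    tsum_mul_left, s3.tsum_add s4]

/-- The product `∏ m < M, (1 + q ^ (4 m + 2) + 2 q ^ (2 m + 1) x)` and its derivative in `x`,
expanded in Chebyshev polynomials and up to a positive factor, are nonnegative for `|x| ≤ 1`: in the
induction, the new factor and its derivative are nonnegative. -/
lemma tsum_tripleCoeff_nonneg (h0 : 0 < q) (h1 : q < 1) {x : ℝ} (hx : |x| ≤ 1) (M : ℕ) :
    0 ≤ ∑' n, tripleCoeff q M n * (T ℝ n).eval x ∧
      0 ≤ ∑' n : ℤ, tripleCoeff q M n * (n * (U ℝ (n - 1)).eval x) := by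
  induction M with
  | zero =>
    have h : ∀ n ≠ 0, tripleCoeff q 0 n = 0 := fun n hn => tripleCoeff_eq_zero (by simpa using hn)
    rw [tsum_eq_single 0 fun n hn => by rw [h n hn, zero_mul],
      tsum_eq_single 0 fun n hn => by rw [h n hn, zero_mul]]
    simp [tripleCoeff, invQPochhammer]
  | succ M ih =>
    have hc : 0 < (1 - q ^ (4 * M + 2)) * (1 - q ^ (4 * M + 4)) :=
      mul_pos (one_sub_pow_pos h0 h1 (by omega)) (one_sub_pow_pos h0 h1 (by omega))
    have hstep := fun f => tsum_mul_of_three_term (finite_support_tripleCoeff M)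
      (tripleCoeff_succ h0 h1 M) f
    have hβ : 0 ≤ q ^ (2 * M + 1) := by positivity
    have hfac : 0 ≤ 1 + q ^ (4 * M + 2) + 2 * x * q ^ (2 * M + 1) := by
      have : q ^ (4 * M + 2) = (q ^ (2 * M + 1)) ^ 2 := by ring
      rw [this]
      nlinarith [sq_nonneg (1 - q ^ (2 * M + 1)), (abs_le.1 hx).1]
    have hT : ∀ n : ℤ, (T ℝ (n + 1)).eval x + (T ℝ (n - 1)).eval x = 2 * x * (T ℝ n).eval x := by
      intro n
      rw [T_add_one]
      simp
    have hU : ∀ n : ℤ, ((n + 1 : ℤ) : ℝ) * (U ℝ (n + 1 - 1)).eval x +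
        ((n - 1 : ℤ) : ℝ) * (U ℝ (n - 1 - 1)).eval x =
        2 * x * (n * (U ℝ (n - 1)).eval x) + 2 * (T ℝ n).eval x := by
      intro n
      have a1 := congrArg (Polynomial.eval x) (U_eq ℝ n)
      have a2 := congrArg (Polynomial.eval x) (two_mul_T_eq_U_sub_U ℝ (n - 2))
      rw [sub_add_cancel] at a2
      simp only [Polynomial.eval_sub, Polynomial.eval_mul, Polynomial.eval_ofNat,
        Polynomial.eval_X] at a1 a2
      rw [add_sub_cancel_right, sub_sub, one_add_one_eq_two]
      push_cast
      linear_combination n * a1 - a2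
    constructor
    · have := hstep fun n => (T ℝ n).eval x
      simp only [hT] at this
      refine nonneg_of_mul_nonneg_right (a := _) ?_ hc
      rw [this]
      have e : ∀ n : ℤ, tripleCoeff q M n * ((1 + q ^ (4 * M + 2)) * (T ℝ n).eval x +
          q ^ (2 * M + 1) * (2 * x * (T ℝ n).eval x)) =
          (1 + q ^ (4 * M + 2) + 2 * x * q ^ (2 * M + 1)) *
            (tripleCoeff q M n * (T ℝ n).eval x) := fun n => by ring
      simp only [e]
      rw [tsum_mul_left]
      exact mul_nonneg hfac ih.1
    · have := hstep fun n => n * (U ℝ (n - 1)).eval x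
      simp only [hU] at this
      refine nonneg_of_mul_nonneg_right (a := _) ?_ hc
      rw [this]
      have e : ∀ n : ℤ, tripleCoeff q M n * ((1 + q ^ (4 * M + 2)) * (n * (U ℝ (n - 1)).eval x) +
          q ^ (2 * M + 1) * (2 * x * (n * (U ℝ (n - 1)).eval x) + 2 * (T ℝ n).eval x)) =
          (1 + q ^ (4 * M + 2) + 2 * x * q ^ (2 * M + 1)) *
            (tripleCoeff q M n * (n * (U ℝ (n - 1)).eval x)) +
          2 * q ^ (2 * M + 1) * (tripleCoeff q M n * (T ℝ n).eval x) := fun n => by ring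
      simp only [e]
      have hs := fun f => summable_mul_of_finite_support (finite_support_tripleCoeff (q := q) M) f
      rw [Summable.tsum_add ((hs _).mul_left _) ((hs _).mul_left _), tsum_mul_left, tsum_mul_left]
      exact add_nonneg (mul_nonneg hfac ih.2) (mul_nonneg (by positivity) ih.1)

lemma invQPochhammer_mul_le (h0 : 0 < q) (h1 : q < 1) (M n : ℕ) :
    invQPochhammer q (M + n) * invQPochhammer q (M - n) ≤ invQPochhammer q M ^ 2 := by
  induction n with
  | zero => simp [sq]
  | succ n ih =>
    have e1 := invQPochhammer_sub_one h0 h1 (M + (n + 1))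
    have e2 := invQPochhammer_sub_one h0 h1 (M - n)
    rw [show (M + (n + 1) - 1 : ℤ) = M + n by ring] at e1
    rw [show (M - n - 1 : ℤ) = M - (n + 1) by ring] at e2
    push_cast
    refine le_trans ?_ ih
    rw [e1, e2]
    have p1 := invQPochhammer_nonneg h0 h1 (M + (n + 1))
    have p2 := invQPochhammer_nonneg h0 h1 (M - n)
    have hz : q ^ (2 * (M + (n + 1)) : ℤ) ≤ q ^ (2 * (M - n) : ℤ) :=
      zpow_le_zpow_right_of_le_one₀ h0 h1.le (by omega)
    nlinarith [mul_nonneg p1 p2]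

lemma tripleCoeff_nonneg (h0 : 0 < q) (h1 : q < 1) (M : ℕ) (n : ℤ) : 0 ≤ tripleCoeff q M n :=
  mul_nonneg (zpow_nonneg h0.le _)
    (mul_nonneg (invQPochhammer_nonneg h0 h1 _) (invQPochhammer_nonneg h0 h1 _))

lemma tripleCoeff_le (h0 : 0 < q) (h1 : q < 1) (M : ℕ) (n : ℤ) :
    tripleCoeff q M n ≤ q ^ (n * n) * invQPochhammer q M ^ 2 := by
  refine mul_le_mul_of_nonneg_left ?_ (zpow_nonneg h0.le _)
  obtain ⟨k, rfl | rfl⟩ := n.eq_nat_or_neg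
  · exact invQPochhammer_mul_le h0 h1 M k
  · rw [mul_comm, sub_neg_eq_add, ← sub_eq_add_neg]
    exact invQPochhammer_mul_le h0 h1 M k

lemma tendsto_invQPochhammer_add_div (h0 : 0 < q) (h1 : q < 1) (n : ℤ) :
    Tendsto (fun M : ℕ => invQPochhammer q (M + n) / invQPochhammer q M) atTop (𝓝 1) := by
  -- consecutive values have the ratio `1 - q ^ (2 (M + n))`, which tends to `1`
  have hlim : ∀ n : ℤ, Tendsto (fun M : ℕ => 1 - q ^ (2 * (M + n) : ℤ)) atTop (𝓝 1) := by
    intro n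
    have h2 : Tendsto (fun M : ℕ => q ^ (2 * n) * (q ^ 2) ^ M) atTop (𝓝 0) := by
      simpa using (tendsto_pow_atTop_nhds_zero_of_lt_one (sq_nonneg q)
        (pow_lt_one₀ h0.le h1 two_ne_zero)).const_mul (q ^ (2 * n))
    have h3 : Tendsto (fun M : ℕ => q ^ (2 * (M + n) : ℤ)) atTop (𝓝 0) := by
      refine h2.congr fun M => ?_
      rw [mul_add, zpow_add₀ h0.ne', zpow_mul q 2 M, mul_comm]
      norm_cast
    simpa using h3.const_sub 1
  induction n with
  | zero =>
    refine tendsto_const_nhds.congr fun M => ?_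
    rw [add_zero, div_self (invQPochhammer_natCast_pos h0 h1 M).ne']
  | succ n ih =>
    have := ih.div (hlim (n + 1)) one_ne_zero
    rw [div_one] at this
    refine this.congr fun M => ?_
    have e := invQPochhammer_sub_one h0 h1 (M + (n + 1))
    rw [show (M + (n + 1) - 1 : ℤ) = M + n by ring] at e
    have hne : 1 - q ^ (2 * (M + (n + 1)) : ℤ) ≠ 0 := by
      rw [show (2 * (M + (n + 1)) : ℤ) = ((2 * (M + (n + 1)) : ℕ) : ℤ) by push_cast; ring,
        zpow_natCast]
      exact (one_sub_pow_pos h0 h1 (by omega)).ne'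
    rw [Pi.div_apply, e, div_right_comm, mul_div_cancel_left₀ _ hne]
  | pred n ih =>
    have := (hlim (-n)).mul ih
    rw [one_mul] at this
    refine this.congr fun M => ?_
    have e := invQPochhammer_sub_one h0 h1 (M + -n)
    rw [show (M + (-n - 1) : ℤ) = M + -n - 1 by ring, e, mul_div_assoc]

lemma tendsto_tripleCoeff (h0 : 0 < q) (h1 : q < 1) (n : ℤ) :
    Tendsto (fun M : ℕ => tripleCoeff q M n / invQPochhammer q M ^ 2) atTop
      (𝓝 (q ^ (n * n))) := by
  have := ((tendsto_invQPochhammer_add_div h0 h1 n).mul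
    (tendsto_invQPochhammer_add_div h0 h1 (-n))).const_mul (q ^ (n * n))
  rw [mul_one, mul_one] at this
  refine this.congr fun M => ?_
  rw [tripleCoeff, sq, mul_div_assoc, mul_div_mul_comm, sub_eq_add_neg]

lemma abs_eval_U_sub_one_le (n : ℤ) {x : ℝ} (hx : |x| ≤ 1) : |(U ℝ (n - 1)).eval x| ≤ |(n : ℝ)| := by
  have main : ∀ k : ℕ, |(U ℝ (k - 1)).eval x| ≤ |(k : ℝ)| := by
    intro k
    rcases k with _ | k
    · simp
    · have := abs_eval_U_le k hx
      rw [abs_of_nonneg (by positivity : (0 : ℝ) ≤ (k + 1 : ℕ))]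
      push_cast
      rwa [add_sub_cancel_right]
  obtain ⟨k, rfl | rfl⟩ := n.eq_nat_or_neg
  · simpa using main k
  · rw [U_neg_sub_one]
    simpa using main k

lemma summable_sq_mul_zpow_sq (h0 : 0 < q) (h1 : q < 1) :
    Summable fun n : ℤ => |(n : ℝ)| * |(n : ℝ)| * q ^ (n * n) := by
  have hnat : Summable fun n : ℕ => |((n : ℤ) : ℝ)| * |((n : ℤ) : ℝ)| * q ^ ((n : ℤ) * n) := by
    refine Summable.of_nonneg_of_le (fun n => ?_) (fun n => ?_)
      (summable_pow_mul_geometric_of_norm_lt_one 2 (r := q) (by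
        rwa [Real.norm_eq_abs, abs_of_pos h0]))
    · positivity
    · have : q ^ ((n : ℤ) * n) ≤ q ^ n := by
        rw [← Nat.cast_mul, zpow_natCast]
        exact pow_le_pow_of_le_one h0.le h1.le (Nat.le_mul_self n)
      simp only [Int.cast_natCast, Nat.abs_cast, ← sq]
      rw [← sq] at this
      gcongr
  refine Summable.of_nat_of_neg hnat ?_
  simpa using hnat

/-- The derivative in `x = cos θ` of the theta function `∑ q ^ n² cos (n θ)` is nonnegative. -/
lemma tsum_theta_deriv_nonneg (h0 : 0 < q) (h1 : q < 1) {x : ℝ} (hx : |x| ≤ 1) :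
    0 ≤ ∑' n : ℤ, q ^ (n * n) * (n * (U ℝ (n - 1)).eval x) := by
  refine ge_of_tendsto' (f := fun M : ℕ => ∑' n : ℤ,
    tripleCoeff q M n / invQPochhammer q M ^ 2 * (n * (U ℝ (n - 1)).eval x)) (x := atTop) ?_ ?_
  · refine tendsto_tsum_of_dominated_convergence (summable_sq_mul_zpow_sq h0 h1)
      (fun n => (tendsto_tripleCoeff h0 h1 n).mul_const _) (Eventually.of_forall fun M n => ?_)
    have hr := invQPochhammer_natCast_pos h0 h1 M
    rw [norm_mul, norm_mul, Real.norm_eq_abs, Real.norm_eq_abs, Real.norm_eq_abs,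
      abs_of_nonneg (div_nonneg (tripleCoeff_nonneg h0 h1 M n) (sq_nonneg _)), mul_comm]
    refine mul_le_mul ?_ ?_ (div_nonneg (tripleCoeff_nonneg h0 h1 M n) (sq_nonneg _)) (by positivity)
    · exact mul_le_mul_of_nonneg_left (abs_eval_U_sub_one_le n hx) (abs_nonneg _)
    · rw [div_le_iff₀ (by positivity)]
      exact tripleCoeff_le h0 h1 M n
  · intro M
    simp only [div_mul_eq_mul_div]
    rw [tsum_div_const]
    exact div_nonneg (tsum_tripleCoeff_nonneg h0 h1 hx M).2 (sq_nonneg _)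

lemma tsum_nat_theta_deriv_nonneg (h0 : 0 < q) (h1 : q < 1) {x : ℝ} (hx : |x| ≤ 1) :
    0 ≤ ∑' m : ℕ, ((m : ℝ) + 1) * q ^ ((m + 1) * (m + 1)) * (U ℝ m).eval x := by
  set f : ℤ → ℝ := fun n => q ^ (n * n) * (n * (U ℝ (n - 1)).eval x) with hf
  have hs : Summable f := by
    refine Summable.of_norm_bounded (summable_sq_mul_zpow_sq h0 h1) fun n => ?_
    rw [hf, norm_mul, norm_mul, Real.norm_eq_abs, Real.norm_eq_abs, Real.norm_eq_abs,
      abs_of_pos (zpow_pos h0 _), mul_comm]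
    exact mul_le_mul_of_nonneg_right
      (mul_le_mul_of_nonneg_left (abs_eval_U_sub_one_le n hx) (abs_nonneg _)) (zpow_pos h0 _).le
  have s1 : Summable fun n : ℕ => f n := hs.comp_injective Nat.cast_injective
  have hneg : ∀ n : ℤ, f (-n) = f n := by
    intro n
    simp only [hf]
    rw [U_neg_sub_one, neg_mul_neg]
    simp
  have s2 : Summable fun n : ℕ => f (-(n + 1)) := by
    simp only [hneg]
    exact_mod_cast (summable_nat_add_iff 1).2 s1
  have h : (0 : ℝ) ≤ ∑' n, f n := tsum_theta_deriv_nonneg h0 h1 hx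
  have hm : ∀ m : ℕ, f (m + 1) =
      ((m : ℝ) + 1) * q ^ ((m + 1) * (m + 1)) * (U ℝ m).eval x := by
    intro m
    simp only [hf]
    rw [add_sub_cancel_right,
      show ((m : ℤ) + 1) * (m + 1) = (((m + 1) * (m + 1) : ℕ) : ℤ) by push_cast; ring, zpow_natCast]
    push_cast
    ring
  rw [tsum_of_nat_of_neg_add_one s1 s2, s1.tsum_eq_zero_add] at h
  simp only [hneg, Nat.cast_add, Nat.cast_one, hm] at h
  have hz : f ((0 : ℕ) : ℤ) = 0 := by simp [hf]
  rw [hz] at h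
  linarith

end TripleProduct

/-! ### The heat kernel -/

/-- The coefficients `(2 j + 1) exp (-t j (j + 1))` of the heat kernel, in terms of `n = 2 j`. -/
noncomputable def heatCoeff (t : ℝ) (n : ℕ) : ℝ :=
  (n + 1) * Real.exp (-t * (n / 2) * (n / 2 + 1))

lemma heatKernel_eq (K : GaugeGroup) (t : ℝ) (g : SU2) :
    heatKernel K t g =
      ∑' m : ℕ, heatCoeff t (K.twiceSpin m) * character (K.twiceSpin m) g := by
  refine tsum_congr fun m => ?_
  rw [heatCoeff, mul_div_cancel₀ _ two_ne_zero]

lemma heatCoeff_pos (t : ℝ) (n : ℕ) : 0 < heatCoeff t n := by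
  unfold heatCoeff
  positivity

lemma GaugeGroup.twiceSpin_injective (K : GaugeGroup) : Function.Injective K.twiceSpin := by
  intro a b h
  cases K <;> simp only [GaugeGroup.twiceSpin] at h <;> omega

lemma summable_heatCoeff {t : ℝ} (ht : 0 < t) :
    Summable fun n : ℕ => heatCoeff t n * (n + 1) := by
  set q := Real.exp (-t / 4) with hq
  have hq1 : ‖q‖ < 1 := by
    rw [Real.norm_eq_abs, abs_of_pos (Real.exp_pos _), Real.exp_lt_one_iff]
    linarith
  have hs : Summable fun n : ℕ => ((n : ℝ) ^ 2 * q ^ n + 2 * ((n : ℝ) ^ 1 * q ^ n) + q ^ n) :=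
    ((summable_pow_mul_geometric_of_norm_lt_one 2 hq1).add
      ((summable_pow_mul_geometric_of_norm_lt_one 1 hq1).mul_left 2)).add
      (summable_geometric_of_norm_lt_one hq1)
  refine Summable.of_nonneg_of_le (fun n => ?_) (fun n => ?_) hs
  · have := heatCoeff_pos t n
    positivity
  · have hle : Real.exp (-t * (n / 2) * (n / 2 + 1)) ≤ q ^ n := by
      rw [hq, ← Real.exp_nat_mul]
      apply Real.exp_le_exp.2
      have : 0 ≤ t * n * (n + 1) := by positivity
      nlinarith
    unfold heatCoeff
    calc _ = ((n : ℝ) + 1) ^ 2 * Real.exp (-t * (n / 2) * (n / 2 + 1)) := by ring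
      _ ≤ ((n : ℝ) + 1) ^ 2 * q ^ n := by gcongr
      _ = _ := by ring

lemma summable_heatCoeff_twiceSpin (K : GaugeGroup) {t : ℝ} (ht : 0 < t) :
    Summable fun m : ℕ => heatCoeff t (K.twiceSpin m) * ((K.twiceSpin m : ℝ) + 1) :=
  (summable_heatCoeff ht).comp_injective K.twiceSpin_injective

lemma norm_heatKernel_term_le (t : ℝ) (n : ℕ) (g : SU2) :
    ‖heatCoeff t n * character n g‖ ≤ heatCoeff t n * (n + 1) := by
  rw [norm_mul, Real.norm_eq_abs, Real.norm_eq_abs, abs_of_pos (heatCoeff_pos t n)]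
  exact mul_le_mul_of_nonneg_left (abs_character_le n g) (heatCoeff_pos t n).le

lemma summable_heatKernel (K : GaugeGroup) {t : ℝ} (ht : 0 < t) (g : SU2) :
    Summable fun m : ℕ => heatCoeff t (K.twiceSpin m) * character (K.twiceSpin m) g :=
  Summable.of_norm_bounded (summable_heatCoeff_twiceSpin K ht)
    fun _ => norm_heatKernel_term_le t _ g

lemma heatKernel_one (K : GaugeGroup) (t : ℝ) : heatKernel K t 1 =
    ∑' m : ℕ, heatCoeff t (K.twiceSpin m) * ((K.twiceSpin m : ℝ) + 1) := by
  simp only [heatKernel_eq, character_one]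

lemma heatKernel_le_heatKernel_one (K : GaugeGroup) {t : ℝ} (ht : 0 < t) (g : SU2) :
    heatKernel K t g ≤ heatKernel K t 1 := by
  rw [heatKernel_one, heatKernel_eq]
  exact (summable_heatKernel K ht g).tsum_le_tsum
    (fun _ => (le_abs_self _).trans (norm_heatKernel_term_le t _ g))
    (summable_heatCoeff_twiceSpin K ht)

lemma continuous_heatKernel (K : GaugeGroup) {t : ℝ} (ht : 0 < t) :
    Continuous (heatKernel K t) := by
  simp only [funext (heatKernel_eq K t)]
  exact continuous_tsum (fun m => continuous_const.mul (continuous_character _))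
    (summable_heatCoeff_twiceSpin K ht) fun m g => norm_heatKernel_term_le t _ g

lemma heatKernel_one_pos (K : GaugeGroup) {t : ℝ} (ht : 0 < t) : 0 < heatKernel K t 1 := by
  rw [heatKernel_one]
  have h : ∀ n : ℕ, 0 < heatCoeff t n * ((n : ℝ) + 1) := fun n =>
    mul_pos (heatCoeff_pos t n) (by positivity)
  exact (summable_heatCoeff_twiceSpin K ht).tsum_pos (fun m => (h _).le) 0 (h _)

/-- The heat kernel at the identity diverges when the regulator is removed. -/
lemma tendsto_heatKernel_one (K : GaugeGroup) :
    Tendsto (fun t => heatKernel K t 1) (𝓝[>] 0) atTop := by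
  rw [tendsto_atTop]
  intro C
  obtain ⟨N, hN⟩ := exists_nat_gt C
  -- as `t → 0` the first `N` terms, each at least `1` at `t = 0`, add up to more than `C`
  have hcont : Tendsto (fun t => ∑ m ∈ Finset.range N,
      heatCoeff t (K.twiceSpin m) * ((K.twiceSpin m : ℝ) + 1)) (𝓝[>] 0)
      (𝓝 (∑ m ∈ Finset.range N,
        heatCoeff 0 (K.twiceSpin m) * ((K.twiceSpin m : ℝ) + 1))) := by
    have : Continuous fun t => ∑ m ∈ Finset.range N,
        heatCoeff t (K.twiceSpin m) * ((K.twiceSpin m : ℝ) + 1) := by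
      unfold heatCoeff
      fun_prop
    exact this.continuousWithinAt
  have hlt : C < ∑ m ∈ Finset.range N,
      heatCoeff 0 (K.twiceSpin m) * ((K.twiceSpin m : ℝ) + 1) := by
    refine hN.trans_le ?_
    calc (N : ℝ) = ∑ m ∈ Finset.range N, (1 : ℝ) := by simp
      _ ≤ _ := Finset.sum_le_sum fun m _ => by
        simp only [heatCoeff, neg_zero, zero_mul, Real.exp_zero, mul_one]
        have : (0 : ℝ) ≤ K.twiceSpin m := Nat.cast_nonneg _
        nlinarith
  filter_upwards [hcont.eventually_const_lt hlt, self_mem_nhdsWithin] with t h1 ht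
  refine h1.le.trans ?_
  rw [heatKernel_one]
  exact (summable_heatCoeff_twiceSpin K ht).sum_le_tsum _ fun m _ =>
    mul_nonneg (heatCoeff_pos t _).le (by positivity)

/-- Positivity of the heat kernel of `SU(2)`, as a function of the cosine of the class angle. -/
lemma tsum_heatCoeff_mul_U_nonneg {t : ℝ} (ht : 0 < t) {x : ℝ} (hx : |x| ≤ 1) :
    0 ≤ ∑' n : ℕ, heatCoeff t n * (Polynomial.Chebyshev.U ℝ n).eval x := by
  have hq1 : Real.exp (-t / 4) < 1 := by
    rw [Real.exp_lt_one_iff]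
    linarith
  have h := tsum_nat_theta_deriv_nonneg (Real.exp_pos (-t / 4)) hq1 hx
  have e : ∀ n : ℕ, heatCoeff t n * (Polynomial.Chebyshev.U ℝ n).eval x =
      Real.exp (t / 4) * (((n : ℝ) + 1) * Real.exp (-t / 4) ^ ((n + 1) * (n + 1)) *
        (Polynomial.Chebyshev.U ℝ n).eval x) := by
    intro n
    rw [heatCoeff, ← Real.exp_nat_mul, mul_comm ((n : ℝ) + 1) (Real.exp _),
      mul_comm ((n : ℝ) + 1) (Real.exp _), ← mul_assoc, ← mul_assoc, ← Real.exp_add]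
    congr 3
    push_cast
    ring
  simp only [e]
  rw [tsum_mul_left]
  exact mul_nonneg (Real.exp_pos _).le h

lemma summable_heatCoeff_mul_U {t : ℝ} (ht : 0 < t) {x : ℝ} (hx : |x| ≤ 1) :
    Summable fun n : ℕ => heatCoeff t n * (Polynomial.Chebyshev.U ℝ n).eval x := by
  refine Summable.of_norm_bounded (summable_heatCoeff ht) fun n => ?_
  rw [norm_mul, Real.norm_eq_abs, Real.norm_eq_abs, abs_of_pos (heatCoeff_pos t n)]
  exact mul_le_mul_of_nonneg_left (abs_eval_U_le n hx) (heatCoeff_pos t n).le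

/-- The heat kernel is nonnegative. That of `SO(3)` is the average of that of `SU(2)` over
`{1, -1}`. -/
lemma heatKernel_nonneg (K : GaugeGroup) {t : ℝ} (ht : 0 < t) (g : SU2) :
    0 ≤ heatKernel K t g := by
  have hx := abs_cosAngle_le g
  have hx' : |-cosAngle g| ≤ 1 := by rwa [abs_neg]
  rw [heatKernel_eq]
  simp only [character_eq]
  cases K with
  | SU2 => exact tsum_heatCoeff_mul_U_nonneg ht hx
  | SO3 =>
    set f := fun n : ℕ => heatCoeff t n * (Polynomial.Chebyshev.U ℝ n).eval (cosAngle g) with hf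
    set f' := fun n : ℕ => heatCoeff t n * (Polynomial.Chebyshev.U ℝ n).eval (-cosAngle g)
      with hf'
    have h1 := summable_heatCoeff_mul_U ht hx
    have h2 := summable_heatCoeff_mul_U ht hx'
    have hadd : (0 : ℝ) ≤ ∑' n, (f n + f' n) := by
      rw [Summable.tsum_add h1 h2]
      exact add_nonneg (tsum_heatCoeff_mul_U_nonneg ht hx) (tsum_heatCoeff_mul_U_nonneg ht hx')
    have hs : Summable fun n => f n + f' n := h1.add h2
    have heven : ∀ m : ℕ, f (2 * m) + f' (2 * m) = 2 * f (2 * m) := by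
      intro m
      simp only [hf, hf']
      rw [Polynomial.Chebyshev.U_eval_neg]
      push_cast
      simp only [Int.negOnePow_two_mul]
      simp
      ring
    have hodd : ∀ m : ℕ, f (2 * m + 1) + f' (2 * m + 1) = 0 := by
      intro m
      simp only [hf, hf']
      rw [Polynomial.Chebyshev.U_eval_neg]
      push_cast
      simp only [Int.negOnePow_two_mul_add_one]
      simp
    change 0 ≤ ∑' m : ℕ, f (2 * m)
    clear_value f f'
    have s1 : Summable fun m : ℕ => f (2 * m) + f' (2 * m) :=
      hs.comp_injective (i := fun m : ℕ => 2 * m) fun a b h => by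
        dsimp only at h
        omega
    have s2 : Summable fun m : ℕ => f (2 * m + 1) + f' (2 * m + 1) :=
      hs.comp_injective (i := fun m : ℕ => 2 * m + 1) fun a b h => by
        dsimp only at h
        omega
    rw [← tsum_even_add_odd (f := fun n => f n + f' n) s1 s2] at hadd
    simp only [heven, hodd, tsum_zero, add_zero] at hadd
    rw [tsum_mul_left] at hadd
    exact nonneg_of_mul_nonneg_right hadd two_pos

/-- The heat kernel is a probability density: only the trivial character contributes to its
integral. -/
lemma integral_heatKernel (K : GaugeGroup) {t : ℝ} (ht : 0 < t) :
    ∫ g, heatKernel K t g ∂haar = 1 := by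
  simp only [heatKernel_eq]
  have hint : ∀ m : ℕ, Integrable
      (fun g => heatCoeff t (K.twiceSpin m) * character (K.twiceSpin m) g) haar := fun m =>
    (continuous_const.mul (continuous_character _)).integrable_of_hasCompactSupport
      (HasCompactSupport.of_compactSpace _)
  rw [← integral_tsum_of_summable_integral_norm hint]
  · rw [tsum_eq_single 0]
    · have h0 : K.twiceSpin 0 = 0 := by cases K <;> rfl
      rw [h0]
      simp [heatCoeff, character_eq]
    · intro m hm
      have h0 : K.twiceSpin m ≠ 0 := by
        cases K <;> simp only [GaugeGroup.twiceSpin] <;> omega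
      rw [integral_const_mul, integral_character_eq_zero h0, mul_zero]
  · refine Summable.of_nonneg_of_le (fun m => integral_nonneg fun g => norm_nonneg _)
      (fun m => ?_) (summable_heatCoeff_twiceSpin K ht)
    calc _ ≤ ∫ g : SU2, heatCoeff t (K.twiceSpin m) * ((K.twiceSpin m : ℝ) + 1) ∂haar :=
          integral_mono (hint m).norm (integrable_const _) fun g => norm_heatKernel_term_le t _ g
      _ = _ := by simp

lemma lintegral_heatKernel (K : GaugeGroup) {t : ℝ} (ht : 0 < t) :
    ∫⁻ g, ENNReal.ofReal (heatKernel K t g) ∂haar = 1 := by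
  rw [← ofReal_integral_eq_lintegral_ofReal, integral_heatKernel K ht, ENNReal.ofReal_one]
  · exact (continuous_heatKernel K ht).integrable_of_hasCompactSupport
      (HasCompactSupport.of_compactSpace _)
  · exact Eventually.of_forall fun g => heatKernel_nonneg K ht g

/-! ### Integrating out single group elements -/

lemma cyc_ne (v : Fin 4) (r : Fin 3) : cyc v r ≠ v := by
  fin_cases v <;> fin_cases r <;> decide

lemma cyc_injective (v : Fin 4) : Function.Injective (cyc v) := by
  fin_cases v <;> decide

lemma exists_cyc_eq {v f : Fin 4} (h : f ≠ v) : ∃ r, cyc v r = f := by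
  revert h
  revert f v
  decide

/-- The left or right translation of the two free group elements of a line of colour `f` which
leaves the group element of the vertex `u` invariant, and translates those of the two other
vertices. -/
noncomputable def translate (f u : Fin 4) (g : SU2) (p : SU2 × SU2) : SU2 × SU2 :=
  if u = cyc f 0 then (p.1, p.2 * g)
  else if u = cyc f 1 then (g * p.1, p.2)
  else (p.1 * g, g⁻¹ * p.2)

lemma strand_translate_self (f u : Fin 4) (g : SU2) (p : SU2 × SU2) :
    strand f (translate f u g p) u = strand f p u := by
  have h01 : cyc f 0 ≠ cyc f 1 := (cyc_injective f).ne (by decide)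
  unfold strand translate
  split_ifs <;> simp_all [mul_assoc]

lemma strand_translate {f u v : Fin 4} (hu : u ≠ f) (hvf : v ≠ f) (hvu : v ≠ u)
    (p : SU2 × SU2) : ∃ a b : SU2, (∀ g, strand f (translate f u g p) v = a * g * b) ∨
      ∀ g, strand f (translate f u g p) v = a * g⁻¹ * b := by
  have h01 : cyc f 0 ≠ cyc f 1 := (cyc_injective f).ne (by decide)
  have h02 : cyc f 0 ≠ cyc f 2 := (cyc_injective f).ne (by decide)
  have h12 : cyc f 1 ≠ cyc f 2 := (cyc_injective f).ne (by decide)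
  have h3 : ∀ r : Fin 3, r = 0 ∨ r = 1 ∨ r = 2 := by decide
  obtain ⟨r, rfl⟩ := exists_cyc_eq hu
  obtain ⟨s, rfl⟩ := exists_cyc_eq hvf
  rcases h3 r with rfl | rfl | rfl <;> rcases h3 s with rfl | rfl | rfl
  · exact absurd rfl hvu
  · exact ⟨p.2, 1, Or.inl fun g => by simp [strand, translate, h01.symm]⟩
  · exact ⟨1, p.2⁻¹ * p.1⁻¹, Or.inr fun g => by
      simp [strand, translate, h02.symm, h12.symm, mul_assoc]⟩
  · exact ⟨1, p.1, Or.inl fun g => by simp [strand, translate, h01.symm]⟩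
  · exact absurd rfl hvu
  · exact ⟨p.2⁻¹ * p.1⁻¹, 1, Or.inr fun g => by
      simp [strand, translate, h02.symm, h12.symm, h01.symm, mul_assoc]⟩
  · exact ⟨p.1, 1, Or.inl fun g => by simp [strand, translate, h02.symm, h12.symm]⟩
  · exact ⟨1, p.2, Or.inr fun g => by simp [strand, translate, h02.symm, h12.symm, h01.symm]⟩
  · exact absurd rfl hvu

lemma exists_mul_translate_mul {s : SU2 → SU2} {a b : SU2}
    (hs : (∀ g, s g = a * g * b) ∨ ∀ g, s g = a * g⁻¹ * b) (p q : SU2) : ∃ a b : SU2,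
      (∀ g, p * s g * q = a * g * b) ∨ ∀ g, p * s g * q = a * g⁻¹ * b :=
  ⟨p * a, b * q, hs.imp (fun h g => by simp only [h, mul_assoc]) fun h g => by
    simp only [h, mul_assoc]⟩

lemma measurePreserving_translate (f u : Fin 4) (g : SU2) :
    MeasurePreserving (translate f u g) (haar.prod haar) (haar.prod haar) := by
  have hl := measurePreserving_mul_left haar
  have hr := measurePreserving_mul_right haar
  have hid := MeasurePreserving.id haar
  by_cases h0 : u = cyc f 0
  · have : translate f u g = Prod.map id (· * g) := by
      funext p
      rw [translate, if_pos h0]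
      rfl
    rw [this]
    exact hid.prod (hr g)
  by_cases h1 : u = cyc f 1
  · have : translate f u g = Prod.map (g * ·) id := by
      funext p
      rw [translate, if_neg h0, if_pos h1]
      rfl
    rw [this]
    exact (hl g).prod hid
  · have : translate f u g = Prod.map (· * g) (g⁻¹ * ·) := by
      funext p
      rw [translate, if_neg h0, if_neg h1]
      rfl
    rw [this]
    exact (hr g).prod (hl g⁻¹)

lemma measurable_translate {α : Type*} [MeasurableSpace α] (f u : Fin 4) {φ : α → SU2}
    {ψ : α → SU2 × SU2} (hφ : Measurable φ) (hψ : Measurable ψ) :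
    Measurable fun a => translate f u (φ a) (ψ a) := by
  unfold translate
  split_ifs <;> fun_prop

lemma measurable_strand (f v : Fin 4) : Measurable fun p => strand f p v := by
  unfold strand
  split_ifs <;> fun_prop

namespace VacuumGraph

variable {B W : Type*} (G : VacuumGraph B W)

/-- The line of colour `f` at a node. -/
def lineAt (n : B ⊕ W) (f : Fin 4) : B × Fin 4 :=
  n.elim (fun b => (b, f)) fun w => ((G.line f).symm w, f)

/-- The product of the group elements around the vertex `v` of the tetrahedron dual to a node. -/
noncomputable def holonomy (x : B × Fin 4 → SU2 × SU2) (d : (B ⊕ W) × Fin 4) : SU2 :=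
  strand (cyc d.2 0) (x (G.lineAt d.1 (cyc d.2 0))) d.2 *
    strand (cyc d.2 1) (x (G.lineAt d.1 (cyc d.2 1))) d.2 *
    strand (cyc d.2 2) (x (G.lineAt d.1 (cyc d.2 2))) d.2

variable {G}

lemma lineAt_snd (n : B ⊕ W) (f : Fin 4) : (G.lineAt n f).2 = f := by
  cases n <;> rfl

lemma measurable_holonomy (d : (B ⊕ W) × Fin 4) : Measurable fun x => G.holonomy x d := by
  have h : ∀ r, Measurable fun x : B × Fin 4 → SU2 × SU2 =>
      strand (cyc d.2 r) (x (G.lineAt d.1 (cyc d.2 r))) d.2 := fun r =>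
    (measurable_strand _ _).comp (measurable_pi_apply _)
  exact ((h 0).mul (h 1)).mul (h 2)

open Classical in
/-- The action of `translate` on the group elements of the line `e`. -/
noncomputable def translateAt (e : B × Fin 4) (u : Fin 4) (g : SU2) (x : B × Fin 4 → SU2 × SU2) :
    B × Fin 4 → SU2 × SU2 :=
  fun i => if i = e then translate e.2 u g (x i) else x i

lemma measurePreserving_translateAt [Fintype B] (e : B × Fin 4) (u : Fin 4) (g : SU2) :
    MeasurePreserving (translateAt e u g) (Measure.pi fun _ : B × Fin 4 => haar.prod haar)
      (Measure.pi fun _ => haar.prod haar) := by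
  classical
  refine measurePreserving_pi (f := fun i p => if i = e then translate e.2 u g p else p) _ _
    fun i => ?_
  by_cases hi : i = e
  · simpa only [hi, if_true] using measurePreserving_translate e.2 u g
  · simp only [hi, if_false]
    exact MeasurePreserving.id _

lemma measurable_translateAt {α : Type*} [MeasurableSpace α] (e : B × Fin 4) (u : Fin 4)
    {φ : α → SU2} {ξ : α → B × Fin 4 → SU2 × SU2} (hφ : Measurable φ) (hξ : Measurable ξ) :
    Measurable fun a => translateAt e u (φ a) (ξ a) := by
  refine measurable_pi_lambda _ fun i => ?_
  have h := measurable_pi_iff.1 hξ i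
  unfold translateAt
  split_ifs
  · exact measurable_translate e.2 u hφ h
  · exact h

lemma holonomy_translateAt_of_ne {e : B × Fin 4} {u : Fin 4} {d : (B ⊕ W) × Fin 4}
    (h : G.lineAt d.1 e.2 ≠ e ∨ d.2 = u ∨ d.2 = e.2) (g : SU2) (x : B × Fin 4 → SU2 × SU2) :
    G.holonomy (translateAt e u g x) d = G.holonomy x d := by
  have key : ∀ r, strand (cyc d.2 r) (translateAt e u g x (G.lineAt d.1 (cyc d.2 r))) d.2 =
      strand (cyc d.2 r) (x (G.lineAt d.1 (cyc d.2 r))) d.2 := by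
    intro r
    unfold translateAt
    split_ifs with he
    · have hc : cyc d.2 r = e.2 := by rw [← he, lineAt_snd]
      rw [hc] at he ⊢
      rcases h with h | h | h
      · exact absurd he h
      · rw [h, strand_translate_self]
      · exact absurd (hc.trans h.symm) (cyc_ne _ _)
    · rfl
  simp only [holonomy, key]

lemma holonomy_translateAt {e : B × Fin 4} {u : Fin 4} {d : (B ⊕ W) × Fin 4}
    (he : G.lineAt d.1 e.2 = e) (hu : u ≠ e.2) (hdu : d.2 ≠ u) (hde : d.2 ≠ e.2)
    (x : B × Fin 4 → SU2 × SU2) : ∃ a b : SU2,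
      (∀ g, G.holonomy (translateAt e u g x) d = a * g * b) ∨
        ∀ g, G.holonomy (translateAt e u g x) d = a * g⁻¹ * b := by
  obtain ⟨r, hr⟩ := exists_cyc_eq hde.symm
  have hsame : ∀ g, strand (cyc d.2 r) (translateAt e u g x (G.lineAt d.1 (cyc d.2 r))) d.2 =
      strand e.2 (translate e.2 u g (x e)) d.2 := by
    intro g
    rw [hr, he, translateAt, if_pos rfl]
  have hother : ∀ s ≠ r, ∀ g,
      strand (cyc d.2 s) (translateAt e u g x (G.lineAt d.1 (cyc d.2 s))) d.2 =
        strand (cyc d.2 s) (x (G.lineAt d.1 (cyc d.2 s))) d.2 := by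
    intro s hs g
    rw [translateAt, if_neg]
    intro h
    refine hs (cyc_injective d.2 ?_)
    rw [hr, ← h, lineAt_snd]
  obtain ⟨a, b, hab⟩ := strand_translate hu hde hdu (x e)
  unfold holonomy
  have h3 : ∀ r : Fin 3, r = 0 ∨ r = 1 ∨ r = 2 := by decide
  rcases h3 r with rfl | rfl | rfl
  · simp only [hsame, hother 1 (by decide), hother 2 (by decide)]
    simpa only [one_mul, mul_assoc] using exists_mul_translate_mul hab 1 (_ * _)
  · simp only [hsame, hother 0 (by decide), hother 2 (by decide)]
    exact exists_mul_translate_mul hab _ _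
  · simp only [hsame, hother 0 (by decide), hother 1 (by decide)]
    simpa only [mul_one] using exists_mul_translate_mul hab (_ * _) 1

/-- If the translations at a line fixing the strand `u` move the argument of a single factor, then
this factor can be integrated out. -/
lemma lintegral_prod_erase [Fintype B] [DecidableEq ((B ⊕ W) × Fin 4)] {h : SU2 → ENNReal}
    (hm : Measurable h)
    (h1 : ∫⁻ g, h g ∂haar = 1) {D : Finset ((B ⊕ W) × Fin 4)} {d : (B ⊕ W) × Fin 4} (hd : d ∈ D)
    {f u : Fin 4} (huf : u ≠ f) (hdu : d.2 ≠ u) (hdf : d.2 ≠ f)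
    (hD : ∀ d' ∈ D, d' ≠ d → G.lineAt d'.1 f ≠ G.lineAt d.1 f ∨ d'.2 = u ∨ d'.2 = f) :
    ∫⁻ x, ∏ d ∈ D, h (G.holonomy x d) ∂(Measure.pi fun _ : B × Fin 4 => haar.prod haar) =
      ∫⁻ x, ∏ d ∈ D.erase d, h (G.holonomy x d)
        ∂(Measure.pi fun _ : B × Fin 4 => haar.prod haar) := by
  set μ : Measure (B × Fin 4 → SU2 × SU2) := Measure.pi fun _ => haar.prod haar
  set e := G.lineAt d.1 f with he
  have hef : e.2 = f := lineAt_snd _ _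
  have hmeas : ∀ D : Finset ((B ⊕ W) × Fin 4), Measurable fun x => ∏ d ∈ D, h (G.holonomy x d) :=
    fun D => Finset.measurable_fun_prod _ fun d _ => hm.comp (measurable_holonomy d)
  calc ∫⁻ x, ∏ d ∈ D, h (G.holonomy x d) ∂μ
      = ∫⁻ _ : SU2, ∫⁻ x, ∏ d ∈ D, h (G.holonomy x d) ∂μ ∂haar := by simp
    _ = ∫⁻ g, ∫⁻ x, ∏ d ∈ D, h (G.holonomy (translateAt e u g x) d) ∂μ ∂haar := by
        refine lintegral_congr fun g => ?_
        exact ((measurePreserving_translateAt e u g).lintegral_comp (hmeas D)).symm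
    _ = ∫⁻ x, ∫⁻ g, ∏ d ∈ D, h (G.holonomy (translateAt e u g x) d) ∂haar ∂μ := by
        refine lintegral_lintegral_swap ?_
        exact ((hmeas D).comp (measurable_translateAt e u measurable_fst measurable_snd)).aemeasurable
    _ = ∫⁻ x, ∏ d ∈ D.erase d, h (G.holonomy x d) ∂μ := by
        refine lintegral_congr fun x => ?_
        have hsplit : ∀ g, ∏ d ∈ D, h (G.holonomy (translateAt e u g x) d) =
            h (G.holonomy (translateAt e u g x) d) * ∏ d ∈ D.erase d, h (G.holonomy x d) := by
          intro g
          rw [← Finset.mul_prod_erase D _ hd]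
          refine congrArg _ (Finset.prod_congr rfl fun d' hd' => ?_)
          rw [holonomy_translateAt_of_ne]
          rw [hef]
          exact hD d' (Finset.mem_of_mem_erase hd') (Finset.ne_of_mem_erase hd')
        simp only [hsplit]
        rw [lintegral_mul_const]
        · obtain ⟨a, b, hab⟩ := holonomy_translateAt (G := G) (e := e) (u := u) (d := d)
            (by rw [hef]) (by rwa [hef]) hdu (by rwa [hef]) x
          rw [lintegral_translate h hab, h1, one_mul]
        · exact hm.comp ((measurable_holonomy d).comp
            (measurable_translateAt e u measurable_id measurable_const))

end VacuumGraph

namespace VacuumGraph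

/-! ### Bubbles, faces and their anchors -/

variable {B W : Type*} (G : VacuumGraph B W)

/-- The node at the other end of the line of colour `f` at a node. -/
def opposite (f : Fin 4) : B ⊕ W → B ⊕ W :=
  Sum.elim (fun b => Sum.inr (G.line f b)) fun w => Sum.inl ((G.line f).symm w)

/-- The bubble of colour `ℓ` containing a node. -/
abbrev bubbleAt (ℓ : Fin 4) (n : B ⊕ W) : G.Bubble ℓ :=
  (G.restrict {ℓ}ᶜ).connectedComponentMk n

/-- The vertices of all the surfaces dual to the bubbles of colour `ℓ`: the connected components
left after deleting the lines of colour `ℓ` and of one further colour. -/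
abbrev Face (ℓ : Fin 4) : Type _ :=
  {v : (ℓ' : Fin 4) × (G.restrict {ℓ, ℓ'}ᶜ).ConnectedComponent // v.1 ≠ ℓ}

variable {G}

lemma adj_restrict_iff {C : Set (Fin 4)} {n n' : B ⊕ W} :
    (G.restrict C).Adj n n' ↔ ∃ f ∈ C, n' = G.opposite f n := by
  constructor
  · rintro ⟨b, f, hf, ⟨rfl, rfl⟩ | ⟨rfl, rfl⟩⟩
    · exact ⟨f, hf, rfl⟩
    · exact ⟨f, hf, by simp [opposite]⟩
  · rintro ⟨f, hf, rfl⟩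
    cases n with
    | inl b => exact ⟨b, f, hf, Or.inl ⟨rfl, rfl⟩⟩
    | inr w => exact ⟨(G.line f).symm w, f, hf, Or.inr ⟨rfl, by simp⟩⟩

lemma lineAt_eq_iff {f : Fin 4} {n n' : B ⊕ W} :
    G.lineAt n' f = G.lineAt n f ↔ n' = n ∨ n' = G.opposite f n := by
  rcases n with b | w <;> rcases n' with b' | w' <;> simp [lineAt, opposite, Equiv.symm_apply_eq]

lemma restrict_mono {C C' : Set (Fin 4)} (h : C ⊆ C') : G.restrict C ≤ G.restrict C' :=
  fun _ _ ⟨b, f, hf, hxy⟩ => ⟨b, f, h hf, hxy⟩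

lemma restrict_compl_pair_le (ℓ v : Fin 4) : G.restrict {ℓ, v}ᶜ ≤ G.restrict {ℓ}ᶜ :=
  restrict_mono (by simp)

/-- The bubbles are ranked by their distance to a root bubble: every other bubble is joined, by a
line of colour `ℓ`, to one which is closer to the root. -/
lemma exists_height (hG : G.Connected) (ℓ : Fin 4) : ∃ (root : G.Bubble ℓ) (H : G.Bubble ℓ → ℕ),
    ∀ b ≠ root, ∃ n, G.bubbleAt ℓ n = b ∧ H (G.bubbleAt ℓ (G.opposite ℓ n)) < H b := by
  have hconn : (G.restrict Set.univ).Connected := hG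
  obtain ⟨n₀⟩ := hconn.nonempty
  set δ : B ⊕ W → ℕ := fun n => (G.restrict Set.univ).dist n n₀ with hδ
  set H : G.Bubble ℓ → ℕ := fun b => sInf (δ '' {n | G.bubbleAt ℓ n = b}) with hH
  have hle : ∀ n, H (G.bubbleAt ℓ n) ≤ δ n := fun n => Nat.sInf_le ⟨n, rfl, rfl⟩
  refine ⟨G.bubbleAt ℓ n₀, H, fun b hb => ?_⟩
  have hne : (δ '' {n | G.bubbleAt ℓ n = b}).Nonempty := by
    obtain ⟨n, hn⟩ := b.exists_rep
    exact ⟨δ n, n, hn, rfl⟩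
  obtain ⟨n, hn, hnH⟩ := Nat.sInf_mem hne
  refine ⟨n, hn, ?_⟩
  obtain ⟨p, hp⟩ := (hconn.preconnected n n₀).exists_walk_length_eq_dist
  cases p with
  | nil => exact absurd hn (Ne.symm hb)
  | @cons _ n' _ h p =>
    have hlt : δ n' < H b := by
      have h1 : δ n' ≤ p.length := SimpleGraph.dist_le p
      have h2 : p.length + 1 = δ n := hp
      have h3 : δ n = H b := hnH
      omega
    obtain ⟨f, -, rfl⟩ := adj_restrict_iff.1 h
    have hf : f = ℓ := by
      by_contra hf
      have : G.bubbleAt ℓ n = G.bubbleAt ℓ (G.opposite f n) :=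
        SimpleGraph.ConnectedComponent.sound
          (adj_restrict_iff.2 ⟨f, by simpa using hf, rfl⟩ : (G.restrict {ℓ}ᶜ).Adj _ _).reachable
      have h4 := hle (G.opposite f n)
      rw [← this, hn] at h4
      omega
    subst hf
    exact (hle _).trans_lt hlt

/-- A set of factors closed under integrating-out moves along the lines of the bubbles is a union
of faces. -/
lemma mem_of_reachable {ℓ v : Fin 4} {D : Finset ((B ⊕ W) × Fin 4)}
    (h : ∀ n f, (n, v) ∈ D → f ≠ ℓ → f ≠ v → (G.opposite f n, v) ∈ D) {n n' : B ⊕ W}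
    (hr : (G.restrict {ℓ, v}ᶜ).Reachable n n') (hn : (n, v) ∈ D) : (n', v) ∈ D := by
  obtain ⟨p⟩ := hr
  induction p with
  | nil => exact hn
  | cons hadj p ih =>
    obtain ⟨f, hf, rfl⟩ := adj_restrict_iff.1 hadj
    simp only [Set.mem_compl_iff, Set.mem_insert_iff, Set.mem_singleton_iff, not_or] at hf
    exact ih (h _ f hn hf.1 hf.2)

/-- The factors at the vertices other than `ℓ` can all be integrated out one after the other, if
one factor is dropped in each face, except for two faces in each bubble other than the root: those
at the anchor, where the line of colour `ℓ` towards the root provides two more group elements. -/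
lemma exists_peelable [Fintype B] [Fintype W] (hG : G.Connected) (ℓ : Fin 4) :
    ∃ R : Finset ((B ⊕ W) × Fin 4),
      R.card + 2 * Nat.card (G.Bubble ℓ) ≤ Nat.card (G.Face ℓ) + 2 ∧
      ∀ D : Finset ((B ⊕ W) × Fin 4), D.Nonempty → (∀ d ∈ D, d.2 ≠ ℓ ∧ d ∉ R) →
        ∃ d ∈ D, ∃ f u : Fin 4, u ≠ f ∧ d.2 ≠ u ∧ d.2 ≠ f ∧
          ∀ d' ∈ D, d' ≠ d → G.lineAt d'.1 f ≠ G.lineAt d.1 f ∨ d'.2 = u ∨ d'.2 = f := by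
  classical
  obtain ⟨root, H, hH⟩ := exists_height hG ℓ
  have : Nonempty (B ⊕ W) := ⟨root.exists_rep.choose⟩
  choose! a ha using hH
  have : Fintype (G.Face ℓ) := Fintype.ofFinite _
  -- the two marked faces of a bubble
  set mark : {b // b ≠ root} × Fin 2 → G.Face ℓ := fun z =>
    ⟨⟨cyc ℓ z.2.castSucc, (G.restrict {ℓ, cyc ℓ z.2.castSucc}ᶜ).connectedComponentMk (a z.1)⟩,
      cyc_ne _ _⟩ with hmark
  have hbub : ∀ {v : Fin 4} {n n' : B ⊕ W}, (G.restrict {ℓ, v}ᶜ).Reachable n n' →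
      G.bubbleAt ℓ n = G.bubbleAt ℓ n' := fun h =>
    SimpleGraph.ConnectedComponent.sound (h.mono (restrict_compl_pair_le _ _))
  have hinj : Function.Injective mark := by
    rintro ⟨⟨b, hb⟩, i⟩ ⟨⟨b', hb'⟩, i'⟩ h
    simp only [hmark, Subtype.mk.injEq, Sigma.mk.injEq] at h
    obtain rfl : i = i' := Fin.castSucc_injective _ (cyc_injective ℓ h.1)
    have hr := hbub (SimpleGraph.ConnectedComponent.exact (eq_of_heq h.2))
    rw [(ha b hb).1, (ha b' hb').1] at hr
    simp [hr]
  have hcm : (Finset.univ.image mark).card + 2 = 2 * Nat.card (G.Bubble ℓ) := by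
    rw [Finset.card_image_of_injective _ hinj, Finset.card_univ, Fintype.card_prod,
      Fintype.card_subtype_compl, Fintype.card_subtype_eq, Fintype.card_fin,
      Nat.card_eq_fintype_card]
    have : 0 < Fintype.card (G.Bubble ℓ) := Fintype.card_pos_iff.2 ⟨root⟩
    omega
  set R : Finset ((B ⊕ W) × Fin 4) :=
    (Finset.univ.image mark)ᶜ.image fun F => (F.1.2.exists_rep.choose, F.1.1) with hR
  refine ⟨R, ?_, ?_⟩
  · have h1 : R.card ≤ (Finset.univ.image mark)ᶜ.card := Finset.card_image_le
    rw [Finset.card_compl, ← Nat.card_eq_fintype_card] at h1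
    have h2 : (Finset.univ.image mark).card ≤ Nat.card (G.Face ℓ) := by
      rw [Nat.card_eq_fintype_card]
      exact Finset.card_le_univ _
    omega
  intro D hDne hD
  by_contra! hno
  -- `u` is the fourth colour: fixing its strand on a line of colour `f`, only `v` and `ℓ` move
  have hcol : ∀ ℓ v f : Fin 4, v ≠ ℓ → f ≠ ℓ → f ≠ v → ∃ u, u ≠ f ∧ v ≠ u ∧
      ∀ v', v' ≠ ℓ → v' ≠ u → v' ≠ f → v' = v := by decide
  -- a factor not removable along a line of its face comes with the factor at the other end
  have hclosed : ∀ n v f, (n, v) ∈ D → f ≠ ℓ → f ≠ v → (G.opposite f n, v) ∈ D := by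
    intro n v f hn hfℓ hfv
    obtain ⟨u, huf, hvu, hu⟩ := hcol ℓ v f (hD _ hn).1 hfℓ hfv
    obtain ⟨⟨n', v'⟩, hd', hne, hline, h1, h2⟩ := hno _ hn f u huf hvu hfv.symm
    obtain rfl : v' = v := hu v' (hD _ hd').1 h1 h2
    rcases lineAt_eq_iff.1 hline with h | h
    · exact absurd (Prod.ext h rfl) hne
    · rwa [← h]
  -- no face contained in `D` has a dropped factor, hence it is one of the marked faces
  have hmarked : ∀ n v, (n, v) ∈ D → ∃ b ≠ root, ∃ i : Fin 2, v = cyc ℓ i.castSucc ∧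
      (a b, v) ∈ D ∧ G.bubbleAt ℓ n = b := by
    intro n v hn
    set F : G.Face ℓ := ⟨⟨v, (G.restrict {ℓ, v}ᶜ).connectedComponentMk n⟩, (hD _ hn).1⟩ with hF
    have hFm : F ∈ Finset.univ.image mark := by
      by_contra hF'
      have hrep : (F.1.2.exists_rep.choose, F.1.1) ∈ R :=
        Finset.mem_image_of_mem _ (Finset.mem_compl.2 hF')
      have hreach : (G.restrict {ℓ, v}ᶜ).Reachable n F.1.2.exists_rep.choose :=
        SimpleGraph.ConnectedComponent.exact F.1.2.exists_rep.choose_spec.symm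
      exact (hD _ (mem_of_reachable (fun n f => hclosed n v f) hreach hn)).2 hrep
    obtain ⟨⟨⟨b, hb⟩, i⟩, -, hz⟩ := Finset.mem_image.1 hFm
    simp only [hmark, hF, Subtype.mk.injEq, Sigma.mk.injEq] at hz
    obtain ⟨rfl, hz⟩ := hz
    have hreach : (G.restrict {ℓ, cyc ℓ i.castSucc}ᶜ).Reachable n (a b) :=
      (SimpleGraph.ConnectedComponent.exact (eq_of_heq hz)).symm
    refine ⟨b, hb, i, rfl, mem_of_reachable (fun n f => hclosed n _ f) hreach hn, ?_⟩
    rw [hbub hreach, (ha b hb).1]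
  obtain ⟨⟨n, v⟩, hn, hmin⟩ := D.exists_min_image (fun d => H (G.bubbleAt ℓ d.1)) hDne
  obtain ⟨b, hb, i, rfl, hab, hnb⟩ := hmarked n v hn
  -- at the line towards the root, fix the strand of the colour of the other marked face
  have hrev : i.rev.castSucc ≠ i.castSucc :=
    (by decide : ∀ i : Fin 2, i.rev.castSucc ≠ i.castSucc) i
  obtain ⟨⟨n', v'⟩, hd', hne, hline, h1, h2⟩ := hno _ hab ℓ (cyc ℓ i.rev.castSucc) (cyc_ne _ _)
    ((cyc_injective ℓ).ne hrev.symm) (cyc_ne _ _)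
  obtain ⟨-, -, i', rfl, -, -⟩ := hmarked n' v' hd'
  have hi' : i' = i :=
    (by decide : ∀ i i' : Fin 2, i' ≠ i.rev → i' = i) i i' fun h => h1 (by rw [h])
  rcases lineAt_eq_iff.1 hline with h | h
  · exact hne (Prod.ext h (by rw [hi']))
  · have h3 : H (G.bubbleAt ℓ n) ≤ H (G.bubbleAt ℓ n') := hmin _ hd'
    have h4 : n' = G.opposite ℓ (a b) := h
    rw [h4, hnb] at h3
    exact absurd h3 (not_le.2 (ha b hb).2)

/-! ### The Euler characteristics of the bubbles -/

lemma sum_card_fiber {α β : Type*} [Finite α] [Fintype β] (p : α → Prop) (φ : α → β) :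
    ∑ b, Nat.card {a // p a ∧ φ a = b} = Nat.card {a // p a} := by
  rw [← Nat.card_sigma]
  refine Nat.card_congr
    { toFun := fun x => ⟨x.2.1, x.2.2.1⟩
      invFun := fun a => ⟨φ a, a, a.2, rfl⟩
      left_inv := ?_
      right_inv := fun _ => rfl }
  rintro ⟨_, a, ha, rfl⟩
  rfl

lemma supp_subset_iff {ℓ v : Fin 4} (c : (G.restrict {ℓ, v}ᶜ).ConnectedComponent)
    (b : G.Bubble ℓ) :
    c.supp ⊆ b.supp ↔ c.map (SimpleGraph.Hom.ofLE (restrict_compl_pair_le ℓ _)) = b := by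
  induction c using SimpleGraph.ConnectedComponent.ind with
  | h n =>
    constructor
    · intro h
      exact h (SimpleGraph.ConnectedComponent.connectedComponentMk_mem)
    · rintro rfl n' hn'
      have hr : (G.restrict {ℓ, v}ᶜ).Reachable n' n := SimpleGraph.ConnectedComponent.exact hn'
      exact SimpleGraph.ConnectedComponent.sound (hr.mono (restrict_compl_pair_le _ _))

variable [Fintype B] [Fintype W]

lemma card_white_eq (G : VacuumGraph B W) : Fintype.card W = Fintype.card B :=
  (Fintype.card_congr (G.line 0)).symm

lemma sum_card_bubbleVertex (ℓ : Fin 4) :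
    ∑ b : G.Bubble ℓ, Nat.card (G.BubbleVertex b) = Nat.card (G.Face ℓ) := by
  rw [← sum_card_fiber (fun v : (ℓ' : Fin 4) × (G.restrict {ℓ, ℓ'}ᶜ).ConnectedComponent =>
    v.1 ≠ ℓ) fun v => v.2.map (SimpleGraph.Hom.ofLE (restrict_compl_pair_le ℓ _))]
  refine Finset.sum_congr rfl fun b _ => ?_
  simp only [BubbleVertex, supp_subset_iff]

lemma sum_card_bubbleEdge (ℓ : Fin 4) :
    ∑ b : G.Bubble ℓ, Nat.card (G.BubbleEdge b) = 3 * Fintype.card B := by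
  have h := sum_card_fiber (fun e : B × Fin 4 => e.2 ≠ ℓ) fun e => G.bubbleAt ℓ (Sum.inl e.1)
  have h2 : Nat.card {e : B × Fin 4 // e.2 ≠ ℓ} = 3 * Fintype.card B := by
    have e : {e : B × Fin 4 // e.2 ≠ ℓ} ≃ B × {f : Fin 4 // f ≠ ℓ} :=
      { toFun := fun e => (e.1.1, ⟨e.1.2, e.2⟩)
        invFun := fun z => ⟨(z.1, z.2.1), z.2.2⟩
        left_inv := fun _ => rfl
        right_inv := fun _ => rfl }
    rw [Nat.card_congr e, Nat.card_prod, Nat.card_eq_fintype_card, Nat.card_eq_fintype_card,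
      Fintype.card_subtype_compl, Fintype.card_subtype_eq, Fintype.card_fin, mul_comm]
  rw [← h2, ← h]
  rfl

lemma sum_card_bubbleFace (ℓ : Fin 4) :
    ∑ b : G.Bubble ℓ, Nat.card (G.BubbleFace b) = 2 * Fintype.card B := by
  have h := sum_card_fiber (fun _ : B ⊕ W => True) fun n => G.bubbleAt ℓ n
  have h2 : Nat.card {_n : B ⊕ W // True} = 2 * Fintype.card B := by
    rw [Nat.card_congr (Equiv.subtypeUnivEquiv fun _ => trivial), Nat.card_eq_fintype_card,
      Fintype.card_sum, card_white_eq G, two_mul]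
  rw [← h2, ← h]
  refine Finset.sum_congr rfl fun b _ => ?_
  simp only [true_and]
  rfl

lemma two_sub_two_mul_sum_genus (ℓ : Fin 4) :
    (2 - 2 * ∑ b : G.Bubble ℓ, G.genus b : ℝ) =
      Nat.card (G.Face ℓ) + 2 - 2 * Nat.card (G.Bubble ℓ) - Fintype.card B := by
  have hV := congrArg (Nat.cast (R := ℝ)) (sum_card_bubbleVertex (G := G) ℓ)
  have hE := congrArg (Nat.cast (R := ℝ)) (sum_card_bubbleEdge (G := G) ℓ)
  have hF := congrArg (Nat.cast (R := ℝ)) (sum_card_bubbleFace (G := G) ℓ)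
  push_cast at hV hE hF
  simp only [genus]
  rw [← Finset.sum_div, Finset.sum_sub_distrib, Finset.sum_add_distrib, Finset.sum_sub_distrib,
    hV, hE, hF, Finset.sum_const, Finset.card_univ, ← Nat.card_eq_fintype_card, nsmul_eq_mul]
  ring

end VacuumGraph

namespace VacuumGraph

/-! ### The bound on the amplitudes -/

variable {B W : Type*} [Fintype B] {G : VacuumGraph B W}

/-- All the factors of a set in which there is always one that can be integrated out integrate to
one. -/
lemma lintegral_prod_eq_one {h : SU2 → ENNReal} (hm : Measurable h)
    (h1 : ∫⁻ g, h g ∂haar = 1) (D : Finset ((B ⊕ W) × Fin 4))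
    (hD : ∀ D' ⊆ D, D'.Nonempty → ∃ d ∈ D', ∃ f u : Fin 4, u ≠ f ∧ d.2 ≠ u ∧ d.2 ≠ f ∧
      ∀ d' ∈ D', d' ≠ d → G.lineAt d'.1 f ≠ G.lineAt d.1 f ∨ d'.2 = u ∨ d'.2 = f) :
    ∫⁻ x, ∏ d ∈ D, h (G.holonomy x d) ∂(Measure.pi fun _ : B × Fin 4 => haar.prod haar) = 1 := by
  classical
  induction D using Finset.strongInduction with
  | H D ih =>
    rcases D.eq_empty_or_nonempty with rfl | hne
    · simp
    · obtain ⟨d, hd, f, u, huf, hdu, hdf, hd'⟩ := hD D subset_rfl hne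
      rw [lintegral_prod_erase hm h1 hd huf hdu hdf hd']
      exact ih _ (Finset.erase_ssubset hd) fun D' hD' =>
        hD D' (hD'.trans (Finset.erase_subset _ _))

variable [Fintype W]

/-- The integrand of the amplitude has one heat kernel for each pair of a node and a colour. -/
lemma integrand_eq (K : GaugeGroup) (t : ℝ) (x : B × Fin 4 → SU2 × SU2) :
    (∏ b : B, interaction K t fun ℓ => strand ℓ (x (b, ℓ))) *
        (∏ w : W, interaction K t fun ℓ => strand ℓ (x ((G.line ℓ).symm w, ℓ))) =
      (∏ d, heatKernel K t (G.holonomy x d)) / heatKernel K t 1 ^ (2 * Fintype.card B) := by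
  have h : ∀ n : B ⊕ W, interaction K t (fun ℓ => strand ℓ (x (G.lineAt n ℓ))) =
      (∏ v, heatKernel K t (G.holonomy x (n, v))) / heatKernel K t 1 := fun n => rfl
  have hN : 2 * Fintype.card B = Fintype.card (B ⊕ W) := by
    rw [Fintype.card_sum, card_white_eq G, two_mul]
  rw [Fintype.prod_prod_type, hN, ← Finset.card_univ, ← Finset.prod_const,
    ← Finset.prod_div_distrib]
  simp only [← h]
  rw [Fintype.prod_sum_type]
  rfl

/-- In the integral of all the heat kernels, those of colour `ℓ` and the ones dropped in
`exists_peelable` are bounded by their value at `1`, and the others integrate to one. -/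
lemma integral_prod_heatKernel_le (hG : G.Connected) (K : GaugeGroup) (ℓ : Fin 4) {t : ℝ}
    (ht : 0 < t) (h1 : 1 ≤ heatKernel K t 1) :
    ∫ x, ∏ d, heatKernel K t (G.holonomy x d) ∂(Measure.pi fun _ : B × Fin 4 => haar.prod haar) ≤
      heatKernel K t 1 ^
        ((2 * Fintype.card B + Nat.card (G.Face ℓ) + 2 - 2 * Nat.card (G.Bubble ℓ) : ℝ)) := by
  classical
  obtain ⟨R, hR, hpeel⟩ := exists_peelable hG ℓ
  set S : Finset ((B ⊕ W) × Fin 4) := Finset.univ.filter fun d => d.2 ≠ ℓ ∧ d ∉ R with hS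
  set δ := heatKernel K t 1 with hδ
  have hm : Measurable (heatKernel K t) := (continuous_heatKernel K ht).measurable
  have hone := lintegral_prod_eq_one (G := G) (ENNReal.measurable_ofReal.comp hm)
    (lintegral_heatKernel K ht) S fun D hD hne => hpeel D hne fun d hd => by
      simpa [hS] using hD hd
  have hcard : Sᶜ.card ≤ 2 * Fintype.card B + R.card := by
    have hsub : Sᶜ ⊆ (Finset.univ.image fun n : B ⊕ W => (n, ℓ)) ∪ R := by
      rintro ⟨n, v⟩ hd
      rw [hS, Finset.mem_compl, Finset.mem_filter, not_and, not_and_or, not_not, not_not] at hd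
      rcases hd (Finset.mem_univ _) with h | h
      · exact Finset.mem_union_left _ (Finset.mem_image.2 ⟨n, Finset.mem_univ _, by rw [← h]⟩)
      · exact Finset.mem_union_right _ h
    have hN : 2 * Fintype.card B = Fintype.card (B ⊕ W) := by
      rw [Fintype.card_sum, card_white_eq G, two_mul]
    rw [hN, ← Finset.card_univ]
    exact (Finset.card_le_card hsub).trans ((Finset.card_union_le _ _).trans
      (Nat.add_le_add_right Finset.card_image_le _))
  have hpt : ∀ x, ENNReal.ofReal (∏ d, heatKernel K t (G.holonomy x d)) ≤
      ENNReal.ofReal (δ ^ Sᶜ.card) * ∏ d ∈ S, ENNReal.ofReal (heatKernel K t (G.holonomy x d)) := by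
    intro x
    rw [← ENNReal.ofReal_prod_of_nonneg fun d _ => heatKernel_nonneg K ht _,
      ← ENNReal.ofReal_mul (by positivity)]
    refine ENNReal.ofReal_le_ofReal ?_
    rw [← Finset.prod_compl_mul_prod S]
    refine mul_le_mul_of_nonneg_right ?_ (Finset.prod_nonneg fun d _ => heatKernel_nonneg K ht _)
    rw [← Finset.prod_const]
    exact Finset.prod_le_prod (fun d _ => heatKernel_nonneg K ht _)
      fun d _ => heatKernel_le_heatKernel_one K ht _
  have hlint : ∫⁻ x, ENNReal.ofReal (∏ d, heatKernel K t (G.holonomy x d))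
      ∂(Measure.pi fun _ : B × Fin 4 => haar.prod haar) ≤ ENNReal.ofReal (δ ^ Sᶜ.card) := by
    refine (lintegral_mono hpt).trans ?_
    rw [lintegral_const_mul']
    · exact (mul_le_mul_right (le_of_eq hone) _).trans (mul_one _).le
    · exact ENNReal.ofReal_ne_top
  rw [integral_eq_lintegral_of_nonneg_ae
    (Eventually.of_forall fun x => Finset.prod_nonneg fun d _ => heatKernel_nonneg K ht _)
    (Finset.measurable_fun_prod _ fun d _ =>
      hm.comp (measurable_holonomy d)).aestronglyMeasurable]
  refine (ENNReal.toReal_mono ENNReal.ofReal_ne_top hlint).trans ?_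
  rw [ENNReal.toReal_ofReal (by positivity), ← Real.rpow_natCast]
  refine Real.rpow_le_rpow_of_exponent_le h1 ?_
  have e1 : (Sᶜ.card : ℝ) ≤ 2 * Fintype.card B + R.card := by exact_mod_cast hcard
  have e2 : (R.card : ℝ) + 2 * Nat.card (G.Bubble ℓ) ≤ Nat.card (G.Face ℓ) + 2 := by
    exact_mod_cast hR
  linarith

/-- The bubble bound for the amplitude itself. -/
lemma amplitude_rescaled_le (hG : G.Connected) (K : GaugeGroup) (lam : ℂ) (ℓ : Fin 4) {t : ℝ}
    (ht : 0 < t) (h1 : 1 ≤ heatKernel K t 1) :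
    amplitude K G (rescaledCoupling K lam t) t ≤ Complex.normSq lam ^ Fintype.card B *
      heatKernel K t 1 ^ (2 - 2 * ∑ b : G.Bubble ℓ, G.genus b : ℝ) := by
  have hδ : 0 < heatKernel K t 1 := heatKernel_one_pos K ht
  have hns : Complex.normSq (rescaledCoupling K lam t) =
      Complex.normSq lam / heatKernel K t 1 := by
    rw [rescaledCoupling, map_div₀, Complex.normSq_ofReal, Real.mul_self_sqrt hδ.le]
  have hI := integral_prod_heatKernel_le hG K ℓ ht h1
  simp only [amplitude, integrand_eq]
  rw [integral_div, hns, div_pow, two_sub_two_mul_sum_genus]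
  have e : (Nat.card (G.Face ℓ) + 2 - 2 * Nat.card (G.Bubble ℓ) - Fintype.card B : ℝ) =
      (2 * Fintype.card B + Nat.card (G.Face ℓ) + 2 - 2 * Nat.card (G.Bubble ℓ) : ℝ) -
        ((Fintype.card B + 2 * Fintype.card B : ℕ) : ℝ) := by
    push_cast
    ring
  rw [e, Real.rpow_sub hδ, Real.rpow_natCast, pow_add, div_mul_div_comm, mul_div_assoc]
  refine mul_le_mul_of_nonneg_left ?_ (pow_nonneg (Complex.normSq_nonneg _) _)
  gcongr

lemma amplitude_nonneg (K : GaugeGroup) (lam : ℂ) {t : ℝ} (ht : 0 < t) :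
    0 ≤ amplitude K G lam t := by
  refine mul_nonneg (pow_nonneg (Complex.normSq_nonneg _) _) (integral_nonneg fun x => ?_)
  rw [integrand_eq]
  exact div_nonneg (Finset.prod_nonneg fun d _ => heatKernel_nonneg K ht _)
    (pow_nonneg (heatKernel_one_pos K ht).le _)

end VacuumGraph

/-- A bound by a power of `δ_t(1)` bounds the divergence degree. -/
lemma divergenceDegree_le (K : GaugeGroup) {A : ℝ → ℝ} {C β : ℝ}
    (h0 : ∀ᶠ t in 𝓝[>] 0, 0 ≤ A t) (h : ∀ᶠ t in 𝓝[>] 0, A t ≤ C * heatKernel K t 1 ^ β) :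
    divergenceDegree K A ≤ (β : EReal) := by
  refine EReal.le_of_forall_lt_iff_le.1 fun γ hγ => sInf_le ⟨γ, ⟨0, ?_⟩, rfl⟩
  have hγ' : 0 < γ - β := sub_pos.2 (EReal.coe_lt_coe_iff.1 hγ)
  have hlim : Tendsto (fun t => C * heatKernel K t 1 ^ (-(γ - β))) (𝓝[>] 0) (𝓝 0) := by
    simpa using ((tendsto_rpow_neg_atTop hγ').comp (tendsto_heatKernel_one K)).const_mul C
  have hpos : ∀ᶠ t in 𝓝[>] (0 : ℝ), 0 < heatKernel K t 1 := by
    filter_upwards [self_mem_nhdsWithin] with t ht using heatKernel_one_pos K ht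
  refine tendsto_of_tendsto_of_tendsto_of_le_of_le' tendsto_const_nhds hlim ?_ ?_
  · filter_upwards [h0, hpos] with t ht hδ
    exact mul_nonneg (Real.rpow_nonneg hδ.le _) ht
  · filter_upwards [h, hpos] with t ht hδ
    calc _ ≤ heatKernel K t 1 ^ (-γ) * (C * heatKernel K t 1 ^ β) :=
          mul_le_mul_of_nonneg_left ht (Real.rpow_nonneg hδ.le _)
      _ = C * (heatKernel K t 1 ^ (-γ) * heatKernel K t 1 ^ β) := by ring
      _ = _ := by
        rw [← Real.rpow_add hδ]
        congr 2
        ring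

end Boulatov

theorem mainTheorem1 (K : Boulatov.GaugeGroup) {B W : Type*} [Fintype B] [Fintype W]
    (G : Boulatov.VacuumGraph B W) (hG : G.Connected) (lam : ℂ) (ℓ : Fin 4) :
    Boulatov.divergenceDegree K
        (fun t => Boulatov.amplitude K G (Boulatov.rescaledCoupling K lam t) t) ≤
      ((2 - 2 * ∑ b : G.Bubble ℓ, G.genus b : ℝ) : EReal) := by
  refine Boulatov.divergenceDegree_le K (C := Complex.normSq lam ^ Fintype.card B) ?_ ?_
  · filter_upwards [self_mem_nhdsWithin] with t ht
    exact Boulatov.VacuumGraph.amplitude_nonneg K _ ht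
  · filter_upwards [self_mem_nhdsWithin,
      (Boulatov.tendsto_heatKernel_one K).eventually_ge_atTop 1] with t ht h1
    exact Boulatov.VacuumGraph.amplitude_rescaled_le hG K lam ℓ ht h1
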